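/- A deck has cards of types $1,\dots,n$, with $m_i\ge 0$ cards of type $i$. Put $N=\sum_i m_i$, $m=N/n$, $m^*=\max_i m_i$ and $\beta_j=\frac1n\sum_{i=1}^n\frac{1}{m^j}\binom{m_i}{j}$. Let $Z=(Z_1,\dots,Z_N)$ be a uniformly random word in which each type $i$ occurs exactly $m_i$ times. For $1\le j\le m^*-1$ and $1\le t\le N$ let $$W_j(t)=\big|\{1\le s_1<\dots<s_{j+1}\le t:\ Z_{s_1}=\dots=Z_{s_{j+1}}\}\big|,$$ and let $T_j$ be the largest $t\in\{1,\dots,N\}$ such that no type occurs more than $j$ times among $Z_1,\dots,Z_t$. Let $d_{TV}(\mu,\nu)=\sup_A|\mu(A)-\nu(A)|$; the total variation distance of two random vectors is that of their laws. **Theorem.** For every integer $k\ge 1$ and every $\epsilon>0$ there is a constant $C=C(k,\epsilon)>0$ such that the following holds for every $n$ and every deck with multiplicities $(m_1,\dots,m_n)$ for which $k\le m^*-1$, the fraction of types $i\in\{1,\dots,n\}$ with $m_i\ge\min(2k+1,m^*)$ is at least $\epsilon$, and $m\ge\epsilon m^*$. For any integers $1\le t_1\le\dots\le t_k\le N$ let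 $$\lambda_j=\frac{t_j^{j+1}\beta_{j+1}}{n^j}\quad(1\le j\le k),\qquad \lambda=\max_{1\le j\le k}\lambda_j .$$ If $P_1,\dots,P_k$ are independent Poisson random variables with $\mathbb E[P_j]=\lambda_j$, then $$d_{TV}\big((W_1(t_1),\dots,W_k(t_k)),(P_1,\dots,P_k)\big)\le C\,(1+\lambda)\Big(\frac{\lambda}{n}\Big)^{\frac1{k+1}},$$ and $$\Big|\mathbb P(T_1\ge t_1,\dots,T_k\ge t_k)-e^{-\sum_{j=1}^k\lambda_j}\Big|\le C\,(1+\lambda)\Big(\frac{\lambda}{n}\Big)^{\frac1{k+1}}.$$ -/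

import Mathlib

open MeasureTheory ProbabilityTheory

namespace CardDeck

/-- The total variation distance `sup_A |μ A - ν A|` of two probability measures. -/
noncomputable def tvDist {α : Type*} [MeasurableSpace α] (μ ν : Measure α) : ℝ :=
  ⨆ A : {A : Set α // MeasurableSet A}, |μ.real A.1 - ν.real A.1|

section Multiplicities

variable {n : ℕ} (m : Fin n → ℕ)

/-- The total number of cards of a deck with `m i` cards of type `i`. -/
def size : ℕ := ∑ i, m i

/-- The average multiplicity. -/
noncomputable def avgMult : ℝ := (size m : ℝ) / n

/-- The largest multiplicity. -/
def maxMult : ℕ := Finset.univ.sup m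

/-- The balance parameter `β_j = (1/n) ∑ i, (m i choose j) / m ^ j`, where the `m` in the
denominator is the average multiplicity. -/
noncomputable def beta (j : ℕ) : ℝ :=
  (1 / (n : ℝ)) * ∑ i, (1 / avgMult m ^ j) * ((m i).choose j : ℝ)

/-- The mean `t ^ (j + 1) β_{j + 1} / n ^ j` of the approximating Poisson variable. -/
noncomputable def poissonMean (j t : ℕ) : ℝ :=
  (t : ℝ) ^ (j + 1) * beta m (j + 1) / (n : ℝ) ^ j

/-- The words in the letters `Fin n` in which each letter `i` occurs exactly `m i` times. -/
def decks : Set (Fin (size m) → Fin n) :=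
  {z | ∀ i, (Finset.univ.filter fun s => z s = i).card = m i}

/-- The law of a thoroughly shuffled deck: the uniform distribution on `decks m`. -/
noncomputable def shuffled : Measure (Fin (size m) → Fin n) := uniformOn (decks m)

end Multiplicities

section Words

/- The positions `0, …, N - 1` of a word stand for the times `1, …, N`, so that the position `s`
belongs to the times up to `t` if and only if `s < t`. -/

variable {N n : ℕ}

/-- The number of cards of type `i` among the first `t` cards. -/
def countUpTo (z : Fin N → Fin n) (t : ℕ) (i : Fin n) : ℕ :=
  (Finset.univ.filter fun s : Fin N => s.val < t ∧ z s = i).card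

/-- `W_j(t)`: the number of increasing `(j + 1)`-tuples of times up to `t` (that is, of sets of
`j + 1` such times) at which all the cards have the same type. -/
def W (j t : ℕ) (z : Fin N → Fin n) : ℕ :=
  (((Finset.univ.filter fun s : Fin N => s.val < t).powersetCard (j + 1)).filter
    fun S => ∀ a ∈ S, ∀ b ∈ S, z a = z b).card

/-- `T_j`: the last time `t ∈ {1, …, N}` such that no type occurs more than `j` times among the
first `t` cards. -/
def T (j : ℕ) (z : Fin N → Fin n) : ℕ :=
  ((Finset.Icc 1 N).filter fun t => ∀ i, countUpTo z t i ≤ j).sup id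

end Words

end CardDeck

/-! The proof is a Stein–Chen argument by switching. `W_j(t_j)` counts the pairs `(α, i)` in which
`α` is a set of `j + 1` positions up to `t_j` whose cards all have type `i`. Put `T = t_k`, the
largest of the times. In a word with `α` of type `i`, exchange the cards at `α` with those at a set
`γ` of `j + 1` positions after `T`. This is a bijection onto the words with `γ` of type `i`; it
usually destroys the collision `α` and changes no other count. Every word has exactly `(m i).choose
(j + 1)` sets `γ` of type `i`, so averaging over all `γ` (few of which meet the first `T` positions)
removes the conditioning. Hence `E[W_j F(W - e_j)] ≈ E[W_j] E[F(W)]` for every bounded function `F`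
of the whole vector: `abs_sum_collisions_mul_sub_le`. The switching fails with conditional
probability `O(T / n)` (`deckCount_collisions_ne_le`), except for sets `α` that contain a potential
smaller collision, and few of these are expected to be monochromatic (`sum_crowded_le`).

Outside the failures the two counts agree exactly, so the Stein solutions only have to be bounded;
their differences play no role. Solving the Stein equation in one coordinate with the others frozen
replaces the coordinates of `W` one by one by independent Poisson variables:
`abs_sum_sub_integral_pi_poisson_le`.

The total error is `O((1 + λ) T / n)`, including the passage from `E[W_j]` to `λ_j`
(`abs_collisionMean_sub_poissonMean_le`). Since `λ_k / n = β_{k+1} (T / n)^(k+1)` and `β_{k+1}` is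
bounded below (`le_beta_succ`), `T / n` is `O((λ / n)^(1/(k+1)))`. If `T / n` is not small, the
claimed bound exceeds 1. The second estimate is the first one at the event `W = 0`. -/

namespace CardDeck

/-! ### Bounded solutions of the Poisson Stein equation. -/

section Stein

/-- The solution of the Stein equation `x * f (w + 1) - w * f w = a w` with `f 0 = 0`. -/
noncomputable def steinSol (x : ℝ) (a : ℕ → ℝ) : ℕ → ℝ
  | 0 => 0
  | w + 1 => (w * steinSol x a w + a w) / x

variable {x : ℝ} {a : ℕ → ℝ}

lemma steinSol_eq (hx : 0 < x) (w : ℕ) :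
    x * steinSol x a (w + 1) - w * steinSol x a w = a w := by
  rw [steinSol]
  field_simp
  ring

lemma steinSol_succ_mul (hx : 0 < x) (w : ℕ) :
    steinSol x a (w + 1) * (x ^ (w + 1) / (w.factorial : ℝ)) =
      ∑ i ∈ Finset.range (w + 1), x ^ i / (i.factorial : ℝ) * a i := by
  induction w with
  | zero => simp [steinSol]; field_simp
  | succ w ih =>
    rw [Finset.sum_range_succ, ← ih, steinSol, Nat.factorial_succ]
    have : (w.factorial : ℝ) ≠ 0 := by positivity
    push_cast
    field_simp
    ring

/-- As the full series vanishes, the partial sum in `steinSol_succ_mul` is minus a tail, and `(i + w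
+ 1)! ≥ w! i!` compares that tail with the exponential series. The bound is crude, but uniform in
`w`, which is what the iteration in `abs_steinSol_le_one_of_ge` needs. -/
lemma abs_steinSol_le_exp (hx : 0 < x) (ha : ∀ i, |a i| ≤ 1)
    (hsum : HasSum (fun i : ℕ => x ^ i / (i.factorial : ℝ) * a i) 0) (w : ℕ) :
    |steinSol x a w| ≤ Real.exp x := by
  cases w with
  | zero => simpa [steinSol] using (Real.exp_pos x).le
  | succ w =>
    have hexp : HasSum (fun i : ℕ => x ^ i / (i.factorial : ℝ)) (Real.exp x) := by
      rw [Real.exp_eq_exp_ℝ]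
      exact NormedSpace.expSeries_div_hasSum_exp x
    have htail := (hasSum_nat_add_iff' (w + 1)).2 hsum
    have hbound : ∀ i : ℕ, ‖x ^ (i + (w + 1)) / ((i + (w + 1)).factorial : ℝ) * a (i + (w + 1))‖
        ≤ x ^ (w + 1) / (w.factorial : ℝ) * (x ^ i / (i.factorial : ℝ)) := by
      intro i
      rw [norm_mul, Real.norm_eq_abs, Real.norm_eq_abs]
      calc _ ≤ |x ^ (i + (w + 1)) / ((i + (w + 1)).factorial : ℝ)| * 1 := by
            gcongr; exact ha _
        _ = x ^ (i + (w + 1)) / ((i + (w + 1)).factorial : ℝ) := by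
            rw [mul_one, abs_of_pos (by positivity)]
        _ ≤ x ^ (i + (w + 1)) / ((w.factorial : ℝ) * (i.factorial : ℝ)) := by
            gcongr
            have h1 : w.factorial * i.factorial ≤ (w + i).factorial :=
              Nat.le_of_dvd (Nat.factorial_pos _) (Nat.factorial_mul_factorial_dvd_factorial_add w i)
            exact_mod_cast h1.trans (Nat.factorial_le (by omega))
        _ = _ := by rw [pow_add]; field_simp
    have hle := tsum_of_norm_bounded (hexp.mul_left (x ^ (w + 1) / (w.factorial : ℝ))) hbound
    rw [htail.tsum_eq, ← steinSol_succ_mul hx, zero_sub, norm_neg, norm_mul, Real.norm_eq_abs,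
      Real.norm_eq_abs, abs_of_pos (show 0 < x ^ (w + 1) / (w.factorial : ℝ) by positivity),
      mul_comm] at hle
    exact le_of_mul_le_mul_left hle (by positivity)

lemma abs_steinSol_le_one_of_le (hx : 0 < x) (ha : ∀ i, |a i| ≤ 1) (w : ℕ) (hw : (w : ℝ) ≤ x) :
    |steinSol x a w| ≤ 1 := by
  induction w with
  | zero => simp [steinSol]
  | succ w ih =>
    push_cast at hw
    have h1 := ih (by linarith)
    rw [steinSol, abs_div, abs_of_pos hx, div_le_one hx]
    calc |(w : ℝ) * steinSol x a w + a w| ≤ |(w : ℝ) * steinSol x a w| + |a w| := abs_add_le _ _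
      _ ≤ w * 1 + 1 := by
        rw [abs_mul, Nat.abs_cast]
        gcongr
        exact ha w
      _ ≤ x := by linarith

/-- The recursion read backwards, stable where `w` is larger than `x`. -/
lemma mul_abs_steinSol_le (hx : 0 < x) (ha : ∀ i, |a i| ≤ 1) (w : ℕ) :
    w * |steinSol x a w| ≤ x * |steinSol x a (w + 1)| + 1 := by
  have h := steinSol_eq (a := a) hx w
  have h2 : (w : ℝ) * steinSol x a w = x * steinSol x a (w + 1) - a w := by linarith
  calc w * |steinSol x a w| = |(w : ℝ) * steinSol x a w| := by rw [abs_mul, Nat.abs_cast]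
    _ ≤ |x * steinSol x a (w + 1)| + |a w| := by rw [h2]; exact abs_sub _ _
    _ ≤ _ := by rw [abs_mul, abs_of_pos hx]; gcongr; exact ha w

lemma abs_steinSol_le_one_of_ge (hx : 0 < x) (ha : ∀ i, |a i| ≤ 1)
    (hsum : HasSum (fun i : ℕ => x ^ i / (i.factorial : ℝ) * a i) 0) (w : ℕ)
    (hw : x + 1 ≤ (w : ℝ)) : |steinSol x a w| ≤ 1 := by
  -- For `w ≥ x + 1` the backward recursion contracts towards 1 with factor `x / (x + 1)`. Starting
  -- it `d` steps further out costs only the crude bound, and `d` tends to infinity.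
  have key : ∀ d : ℕ, ∀ w : ℕ, x + 1 ≤ (w : ℝ) →
      |steinSol x a w| ≤ 1 + Real.exp x * (x / (x + 1)) ^ d := by
    intro d
    induction d with
    | zero =>
      intro w _
      have := abs_steinSol_le_exp hx ha hsum w
      simp only [pow_zero, mul_one]
      linarith
    | succ d ih =>
      intro w hw
      have h1 := ih (w + 1) (by push_cast; linarith)
      have h2 := mul_abs_steinSol_le hx ha w
      have h3 : (x + 1) * |steinSol x a w| ≤ w * |steinSol x a w| := by gcongr
      have h4 : x * |steinSol x a (w + 1)| ≤ x * (1 + Real.exp x * (x / (x + 1)) ^ d) := by gcongr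
      have h5 : (x + 1) * (1 + Real.exp x * (x / (x + 1)) ^ (d + 1)) =
          x * (1 + Real.exp x * (x / (x + 1)) ^ d) + 1 := by
        rw [pow_succ]; field_simp; ring
      refine le_of_mul_le_mul_left ?_ (show 0 < x + 1 by linarith)
      linarith
  have hlim : Filter.Tendsto (fun d : ℕ => 1 + Real.exp x * (x / (x + 1)) ^ d) Filter.atTop
      (nhds (1 + Real.exp x * 0)) :=
    ((tendsto_pow_atTop_nhds_zero_of_lt_one (by positivity)
      ((div_lt_one (by linarith)).2 (by linarith))).const_mul _).const_add _
  rw [mul_zero, add_zero] at hlim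
  exact ge_of_tendsto' hlim fun d => key d w hw

lemma abs_steinSol_le_two (hx : 0 < x) (ha : ∀ i, |a i| ≤ 1)
    (hsum : HasSum (fun i : ℕ => x ^ i / (i.factorial : ℝ) * a i) 0) (w : ℕ) :
    |steinSol x a w| ≤ 2 := by
  rcases le_or_gt (w : ℝ) x with h | h
  · linarith [abs_steinSol_le_one_of_le hx ha w h]
  -- One backward step from `w + 1` also covers the gap `x < w < x + 1`: `w |f w| ≤ x + 1 ≤ 2 w`.
  · have h1 := abs_steinSol_le_one_of_ge hx ha hsum (w + 1) (by push_cast; linarith)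
    have h2 := mul_abs_steinSol_le hx ha w
    have hw : (1 : ℝ) ≤ w := by
      have : 0 < w := by
        by_contra h0
        have : w = 0 := by omega
        subst this
        simp at h
        linarith
      exact_mod_cast this
    have h3 : x * |steinSol x a (w + 1)| ≤ x * 1 := by gcongr
    refine le_of_mul_le_mul_left ?_ (show (0 : ℝ) < w by linarith)
    linarith

end Stein

/-- Every function with values in `[0, 1]` has a Stein solution bounded by `2`. -/
lemma exists_stein_solution {r : NNReal} (hr : 0 < r) (h : ℕ → ℝ) (h0 : ∀ w, 0 ≤ h w)
    (h1 : ∀ w, h w ≤ 1) :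
    ∃ f : ℕ → ℝ, (∀ w, |f w| ≤ 2) ∧
      ∀ w : ℕ, r * f (w + 1) - w * f w = h w - ∫ v, h v ∂poissonMeasure r := by
  set c := ∫ v, h v ∂poissonMeasure r with hc
  have hint : Integrable h (poissonMeasure r) :=
    Integrable.of_bound (C := 1) Measurable.of_discrete.aestronglyMeasurable
      (Filter.Eventually.of_forall fun w => by
        rw [Real.norm_eq_abs, abs_of_nonneg (h0 w)]; exact h1 w)
  have hc0 : 0 ≤ c := integral_nonneg h0
  have hc1 : c ≤ 1 := by
    calc c ≤ ∫ _, (1 : ℝ) ∂poissonMeasure r := integral_mono hint (integrable_const _) h1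
      _ = 1 := by simp
  have ha : ∀ i, |h i - c| ≤ 1 := fun i => abs_le.2 ⟨by linarith [h0 i], by linarith [h1 i]⟩
  have hsum : HasSum (fun i : ℕ => (r : ℝ) ^ i / (i.factorial : ℝ) * (h i - c)) 0 := by
    have e1 := hasSum_integral_poissonMeasure (hint.sub (integrable_const c))
    have e2 : ∫ v, (h v - c) ∂poissonMeasure r = 0 := by
      rw [integral_sub hint (integrable_const c)]
      simp [hc]
    simp only [Pi.sub_apply, smul_eq_mul, e2] at e1
    have e3 := e1.mul_left (Real.exp r)
    rw [mul_zero] at e3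
    convert! e3 using 2 with i
    rw [Real.exp_neg]
    field_simp
  have hr' : (0 : ℝ) < r := hr
  exact ⟨steinSol r fun i => h i - c, abs_steinSol_le_two hr' ha hsum, steinSol_eq hr'⟩

/-! ### Poisson approximation of vectors, one coordinate at a time. -/

/-- Resampling one coordinate of a product measure does not change it. -/
lemma integral_pi_resample {k : ℕ} (μ : Fin k → Measure ℕ) [∀ i, IsProbabilityMeasure (μ i)]
    (j : Fin k) (G : (Fin k → ℕ) → ℝ) (hG : ∀ p, |G p| ≤ 1) :
    ∫ p, ∫ v, G (Function.update p j v) ∂μ j ∂Measure.pi μ = ∫ p, G p ∂Measure.pi μ := by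
  have hmap : ((Measure.pi μ).prod (μ j)).map (fun q => Function.update q.1 j q.2) =
      Measure.pi μ := by
    symm
    refine Measure.pi_eq fun s hs => ?_
    rw [Measure.map_apply Measurable.of_discrete (MeasurableSet.univ_pi hs)]
    have : (fun q : (Fin k → ℕ) × ℕ => Function.update q.1 j q.2) ⁻¹' Set.univ.pi s =
        (Set.univ.pi (Function.update s j Set.univ)) ×ˢ s j := by
      ext ⟨p, v⟩
      simp only [Set.mem_preimage, Set.mem_pi, Set.mem_univ, true_implies, Set.mem_prod]
      constructor
      · intro h
        refine ⟨fun i => ?_, by simpa using h j⟩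
        by_cases hi : i = j
        · subst hi; simp
        · simpa [hi] using h i
      · rintro ⟨h1, h2⟩ i
        by_cases hi : i = j
        · subst hi; simpa using h2
        · simpa [hi] using h1 i
    rw [this, Measure.prod_prod, Measure.pi_pi, ← Finset.mul_prod_erase _ _ (Finset.mem_univ j),
      ← Finset.mul_prod_erase _ (fun i => μ i (s i)) (Finset.mem_univ j), mul_comm]
    simp only [Function.update_self, measure_univ, one_mul]
    congr 1
    refine Finset.prod_congr rfl fun i hi => ?_
    rw [Function.update_of_ne (Finset.ne_of_mem_erase hi)]
  conv_rhs => rw [← hmap]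
  rw [integral_map Measurable.of_discrete.aemeasurable Measurable.of_discrete.aestronglyMeasurable]
  rw [integral_prod]
  exact Integrable.of_bound (C := 1) Measurable.of_discrete.aestronglyMeasurable
    (Filter.Eventually.of_forall fun w => by rw [Real.norm_eq_abs]; exact hG _)

/-- The vector with the coordinates of `u` before `j` and those of `p` from `j` on. -/
def splice {k : ℕ} (j : ℕ) (u p : Fin k → ℕ) : Fin k → ℕ := fun i => if i.val < j then u i else p i

lemma splice_update {k : ℕ} (j : Fin k) (u p : Fin k → ℕ) (v : ℕ) :
    splice j u (Function.update p j v) = Function.update (splice j u p) j v := by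
  ext i
  by_cases hi : i = j
  · subst hi; simp [splice]
  · simp [splice, hi]

lemma splice_succ {k : ℕ} (j : Fin k) (u p : Fin k → ℕ) :
    splice (j + 1) u p = Function.update (splice j u p) j (u j) := by
  ext i
  by_cases hi : i = j
  · subst hi; simp [splice]
  · have : i.val ≠ j.val := fun h => hi (Fin.ext h)
    have h2 : i.val < j.val + 1 ↔ i.val < j.val := by omega
    simp [splice, hi, h2]

/-- Coordinate `j` of the splice comes from `p`, so a test function built on it does not notice the
removal of one collision of kind `j`. -/
lemma splice_sub_single {k : ℕ} (j : Fin k) (u p : Fin k → ℕ) :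
    splice j (u - Pi.single j 1) p = splice j u p := by
  ext i
  by_cases hi : i = j
  · subst hi; simp [splice]
  · simp [splice, hi]

/-- Poisson approximation of a vector by comparing coordinates one at a time: it suffices to know
that each coordinate almost satisfies the Stein identity against bounded functions of the whole
vector. -/
theorem abs_sum_sub_integral_pi_poisson_le {k : ℕ} {Z : Type*} (D : Finset Z)
    (w : Z → Fin k → ℕ) (r : Fin k → NNReal) (hr : ∀ j, 0 < r j) (err : Fin k → ℝ)
    (herr : ∀ j, ∀ F : (Fin k → ℕ) → ℝ, (∀ u, |F u| ≤ 2) →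
      |∑ z ∈ D, (w z j * F (w z - Pi.single j 1)) - r j * ∑ z ∈ D, F (w z)| ≤ err j)
    (h : (Fin k → ℕ) → ℝ) (h0 : ∀ u, 0 ≤ h u) (h1 : ∀ u, h u ≤ 1) :
    |∑ z ∈ D, h (w z) - D.card * ∫ p, h p ∂Measure.pi fun j => poissonMeasure (r j)|
      ≤ ∑ j, err j := by
  set μ := Measure.pi fun j => poissonMeasure (r j) with hμ
  have habs : ∀ u, |h u| ≤ 1 := fun u => by rw [abs_of_nonneg (h0 u)]; exact h1 u
  have hint : ∀ g : (Fin k → ℕ) → (Fin k → ℕ), Integrable (fun p => h (g p)) μ := fun g =>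
    Integrable.of_bound (C := 1) Measurable.of_discrete.aestronglyMeasurable
      (Filter.Eventually.of_forall fun w => by rw [Real.norm_eq_abs]; exact habs _)
  have hstep : ∀ j : Fin k,
      |∑ z ∈ D, ∫ p, h (splice (j + 1) (w z) p) ∂μ - ∑ z ∈ D, ∫ p, h (splice j (w z) p) ∂μ|
        ≤ err j := by
    intro j
    have hre : ∀ z, ∫ p, h (splice j (w z) p) ∂μ =
        ∫ p, ∫ v, h (Function.update (splice j (w z) p) j v) ∂poissonMeasure (r j) ∂μ := by
      intro z
      rw [hμ, ← integral_pi_resample _ j (fun p => h (splice j (w z) p)) fun p => habs _]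
      simp only [splice_update]
    have hint2 : ∀ z, Integrable (fun p => ∫ v, h (Function.update (splice j (w z) p) j v)
        ∂poissonMeasure (r j)) μ := fun z =>
      Integrable.of_bound (C := 1) Measurable.of_discrete.aestronglyMeasurable
        (Filter.Eventually.of_forall fun p => by
          refine (norm_integral_le_of_norm_le_const (C := 1)
            (Filter.Eventually.of_forall fun v => ?_)).trans (by simp)
          rw [Real.norm_eq_abs]; exact habs _)
    simp_rw [hre]
    rw [← integral_finsetSum _ fun z _ => hint _, ← integral_finsetSum _ fun z _ => hint2 z,
      ← integral_sub (integrable_finsetSum _ fun z _ => hint _)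
        (integrable_finsetSum _ fun z _ => hint2 z), ← Real.norm_eq_abs]
    refine (norm_integral_le_of_norm_le_const (C := err j)
      (Filter.Eventually.of_forall fun p => ?_)).trans (by simp)
    rw [Real.norm_eq_abs, ← Finset.sum_sub_distrib]
    choose f hf1 hf2 using fun u : Fin k → ℕ => exists_stein_solution (hr j)
      (fun v => h (Function.update u j v)) (fun _ => h0 _) (fun _ => h1 _)
    -- The shift by one makes `F (w z)` equal to `f (w z j + 1)` and `F (w z - Pi.single j 1)` equal
    -- to `f (w z j)`. Where `w z j = 0` the subtraction is truncated, but the factor `w z j`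
    -- vanishes.
    have hF := herr j (fun u => f (splice j u p) (u j + 1)) fun u => hf1 _ _
    rw [abs_sub_comm, Finset.mul_sum, ← Finset.sum_sub_distrib] at hF
    refine le_of_eq_of_le (congrArg _ (Finset.sum_congr rfl fun z _ => ?_)) hF
    rw [splice_succ, ← hf2, splice_sub_single]
    congr 1
    rcases Nat.eq_zero_or_pos (w z j) with h00 | hpos
    · simp [h00]
    · simp only [Pi.sub_apply, Pi.single_eq_same, Nat.sub_add_cancel hpos]
  have htel : ∀ J : ℕ, ∀ hJ : J ≤ k,
      |∑ z ∈ D, ∫ p, h (splice J (w z) p) ∂μ - ∑ z ∈ D, ∫ p, h (splice 0 (w z) p) ∂μ|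
        ≤ ∑ j : Fin J, err (Fin.castLE hJ j) := by
    intro J
    induction J with
    | zero => intro _; simp
    | succ J ih =>
      intro hJ
      rw [Fin.sum_univ_castSucc]
      have e1 := ih (by omega)
      have e2 := hstep ⟨J, hJ⟩
      exact (abs_sub_le _ _ _).trans ((add_le_add e2 e1).trans_eq (add_comm _ _))
  have hfin := htel k le_rfl
  have hs0 : ∀ u p : Fin k → ℕ, splice 0 u p = p := fun u p => by ext i; simp [splice]
  have hsk : ∀ u p : Fin k → ℕ, splice k u p = u := fun u p => by ext i; simp [splice]
  simpa [hs0, hsk] using hfin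

/-! ### Counting words with prescribed letters by exchangeability. -/

section Counting

variable {N n : ℕ}

/-- The words of length `N` in which each letter `i` occurs exactly `m i` times. -/
def deckFinset (N : ℕ) (m : Fin n → ℕ) : Finset (Fin N → Fin n) :=
  Finset.univ.filter fun z => ∀ i, (Finset.univ.filter fun s => z s = i).card = m i

open Classical in
/-- The number of words with multiplicities `m` that satisfy `P`. -/
noncomputable def deckCount (m : Fin n → ℕ) (P : (Fin N → Fin n) → Prop) : ℝ :=
  ((deckFinset N m).filter P).card

variable {m : Fin n → ℕ}

lemma mem_deckFinset {z : Fin N → Fin n} :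
    z ∈ deckFinset N m ↔ ∀ i, (Finset.univ.filter fun s => z s = i).card = m i := by
  simp [deckFinset]

open Classical in
lemma deckCount_eq_sum (P : (Fin N → Fin n) → Prop) :
    deckCount m P = ∑ z ∈ deckFinset N m, if P z then (1 : ℝ) else 0 := by
  rw [deckCount, Finset.sum_boole]

lemma deckCount_nonneg (P : (Fin N → Fin n) → Prop) : 0 ≤ deckCount m P := Nat.cast_nonneg _

lemma deckCount_mono {P Q : (Fin N → Fin n) → Prop} (h : ∀ z, P z → Q z) :
    deckCount m P ≤ deckCount m Q := by
  classical
  unfold deckCount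
  refine Nat.cast_le.2 (Finset.card_le_card fun z hz => ?_)
  rw [Finset.mem_filter] at hz ⊢
  exact ⟨hz.1, h z hz.2⟩

lemma deckCount_congr {P Q : (Fin N → Fin n) → Prop} (h : ∀ z, P z ↔ Q z) :
    deckCount m P = deckCount m Q :=
  le_antisymm (deckCount_mono fun z => (h z).1) (deckCount_mono fun z => (h z).2)

lemma deckCount_or_le (P Q : (Fin N → Fin n) → Prop) :
    deckCount m (fun z => P z ∨ Q z) ≤ deckCount m P + deckCount m Q := by
  classical
  unfold deckCount
  refine le_trans (Nat.cast_le.2 (Finset.card_le_card fun z hz => ?_))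
    (le_of_le_of_eq (Nat.cast_le.2 (Finset.card_union_le _ _)) (Nat.cast_add _ _))
  simp only [Finset.mem_filter, Finset.mem_union] at hz ⊢
  tauto

lemma deckCount_exists_le {ι : Type*} (I : Finset ι) (P : ι → (Fin N → Fin n) → Prop) :
    deckCount m (fun z => ∃ i ∈ I, P i z) ≤ ∑ i ∈ I, deckCount m (P i) := by
  classical
  induction I using Finset.induction_on with
  | empty => simp [deckCount]
  | insert a I ha ih =>
    rw [Finset.sum_insert ha]
    refine le_trans (le_trans (deckCount_mono fun z hz => ?_)
      (deckCount_or_le (P a) fun z => ∃ i ∈ I, P i z)) (by gcongr)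
    simpa using hz

lemma sum_deckFinset_comp_perm (π : Equiv.Perm (Fin N)) (φ : (Fin N → Fin n) → ℝ) :
    ∑ z ∈ deckFinset N m, φ (z ∘ π) = ∑ z ∈ deckFinset N m, φ z := by
  refine Finset.sum_equiv (Equiv.arrowCongr π.symm (Equiv.refl _)) (fun z => ?_) fun z _ => ?_
  · simp only [mem_deckFinset]
    refine forall_congr' fun i => ?_
    have : (Finset.univ.filter fun s => (Equiv.arrowCongr π.symm (Equiv.refl _)) z s = i).card =
        (Finset.univ.filter fun s => z s = i).card := by
      refine Finset.card_equiv π fun s => ?_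
      simp
    rw [this]
  · congr 1

lemma deckCount_comp_perm (π : Equiv.Perm (Fin N)) (P : (Fin N → Fin n) → Prop) :
    deckCount m (fun z => P (z ∘ π)) = deckCount m P := by
  classical
  rw [deckCount_eq_sum, deckCount_eq_sum,
    sum_deckFinset_comp_perm π fun z => if P z then (1 : ℝ) else 0]

/-- Prescribing the type of one more card, outside of the positions `Q` that decide about the
event `E` and about the prescribed type `c`. -/
lemma mul_deckCount_and_le {M : ℕ} (hM : ∀ i, m i ≤ M) (Q : Finset (Fin N))
    (E : (Fin N → Fin n) → Prop) (c : (Fin N → Fin n) → Fin n)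
    (hE : ∀ z z' : Fin N → Fin n, (∀ q ∈ Q, z q = z' q) → (E z ↔ E z'))
    (hc : ∀ z z' : Fin N → Fin n, (∀ q ∈ Q, z q = z' q) → c z = c z')
    {x : Fin N} (hx : x ∉ Q) :
    ((N : ℝ) - Q.card) * deckCount m (fun z => E z ∧ z x = c z) ≤ M * deckCount m E := by
  classical
  -- All positions outside `Q` are exchangeable, because a swap of two of them affects neither `E`
  -- nor `c`. Summing over them, each word contributes at most `M`, the bound on the multiplicity of
  -- the letter `c z`.
  have hsym : ∀ y ∈ Qᶜ, deckCount m (fun z => E z ∧ z y = c z) =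
      deckCount m (fun z => E z ∧ z x = c z) := by
    intro y hy
    rw [← deckCount_comp_perm (Equiv.swap x y) fun z => E z ∧ z x = c z]
    refine deckCount_congr fun z => ?_
    have hq : ∀ q ∈ Q, z q = (z ∘ Equiv.swap x y) q := fun q hq => by
      rw [Function.comp_apply, Equiv.swap_apply_of_ne_of_ne]
      · rintro rfl; exact hx hq
      · rintro rfl; exact Finset.mem_compl.1 hy hq
    rw [hE z _ hq, hc z _ hq]
    simp
  have h1 : ((N : ℝ) - Q.card) * deckCount m (fun z => E z ∧ z x = c z) =
      ∑ y ∈ Qᶜ, deckCount m (fun z => E z ∧ z y = c z) := by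
    rw [Finset.sum_congr rfl hsym, Finset.sum_const, nsmul_eq_mul, Finset.card_compl,
      Fintype.card_fin, Nat.cast_sub]
    simpa using Finset.card_le_univ Q
  rw [h1]
  simp_rw [deckCount_eq_sum]
  rw [Finset.sum_comm, Finset.mul_sum]
  refine Finset.sum_le_sum fun z hz => ?_
  by_cases h : E z
  · simp only [h, true_and, if_true, mul_one]
    rw [Finset.sum_boole]
    have : (Qᶜ.filter fun y => z y = c z).card ≤ M :=
      (Finset.card_le_card (Finset.filter_subset_filter _ (Finset.subset_univ _))).trans
        ((mem_deckFinset.1 hz (c z)).trans_le (hM _))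
    exact_mod_cast this
  · simp [h]

/-- Prescribing the type of several more cards. -/
lemma deckCount_and_forall_le {M : ℕ} (hM : ∀ i, m i ≤ M) {ρ : ℝ} {R : ℕ} (hR : (R : ℝ) < N)
    (hρ : (M : ℝ) ≤ ρ * ((N : ℝ) - R)) (Q : Finset (Fin N))
    (E : (Fin N → Fin n) → Prop) (c : (Fin N → Fin n) → Fin n)
    (hE : ∀ z z' : Fin N → Fin n, (∀ q ∈ Q, z q = z' q) → (E z ↔ E z'))
    (hc : ∀ z z' : Fin N → Fin n, (∀ q ∈ Q, z q = z' q) → c z = c z')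
    (S : Finset (Fin N)) (hS : Disjoint Q S) (hcard : Q.card + S.card ≤ R) :
    deckCount m (fun z => E z ∧ ∀ s ∈ S, z s = c z) ≤ ρ ^ S.card * deckCount m E := by
  classical
  have hρ0 : 0 ≤ ρ := by
    by_contra h
    have : ρ * ((N : ℝ) - R) < 0 := mul_neg_of_neg_of_pos (by linarith) (by linarith)
    linarith [(Nat.cast_nonneg M : (0 : ℝ) ≤ M)]
  induction S using Finset.induction_on with
  | empty => simp
  | insert x S hx ih =>
    rw [Finset.disjoint_insert_right] at hS
    rw [Finset.card_insert_of_notMem hx] at hcard ⊢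
    have ih' := ih hS.2 (by omega)
    have hxQ : x ∉ Q ∪ S := by simp [hS.1, hx]
    have key := mul_deckCount_and_le hM (Q ∪ S) (fun z => E z ∧ ∀ s ∈ S, z s = c z) c
      (fun z z' h => by
        have h1 : ∀ q ∈ Q, z q = z' q := fun q hq => h q (Finset.mem_union_left _ hq)
        rw [hE z z' h1, hc z z' h1]
        exact and_congr_right fun _ => forall₂_congr fun s hs => by
          rw [h s (Finset.mem_union_right _ hs)])
      (fun z z' h => hc z z' fun q hq => h q (Finset.mem_union_left _ hq)) hxQ
    rw [Finset.card_union_of_disjoint hS.2] at key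
    have hcardR : (((Q.card + S.card : ℕ) : ℝ)) ≤ R := by exact_mod_cast (by omega)
    set A := deckCount m (fun z => (E z ∧ ∀ s ∈ S, z s = c z) ∧ z x = c z)
    set B := deckCount m (fun z => E z ∧ ∀ s ∈ S, z s = c z)
    have hA0 : 0 ≤ A := deckCount_nonneg _
    have hB0 : 0 ≤ B := deckCount_nonneg _
    have hAB : A ≤ ρ * B := by
      refine le_of_mul_le_mul_left ?_ (show 0 < (N : ℝ) - R by linarith)
      calc ((N : ℝ) - R) * A ≤ ((N : ℝ) - ((Q.card + S.card : ℕ) : ℝ)) * A := by gcongr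
        _ ≤ M * B := key
        _ ≤ ρ * ((N : ℝ) - R) * B := by gcongr
        _ = _ := by ring
    have heq : deckCount m (fun z => E z ∧ ∀ s ∈ insert x S, z s = c z) = A :=
      deckCount_congr fun z => by simp only [Finset.forall_mem_insert]; tauto
    rw [heq, pow_succ]
    calc A ≤ ρ * B := hAB
      _ ≤ ρ * (ρ ^ S.card * deckCount m E) := by gcongr
      _ = _ := by ring

/-- Two sets of positions of the same size are exchanged by an involution. -/
lemma exists_involutive_exchange {X : Type*} [DecidableEq X] (α γ : Finset X)
    (h : α.card = γ.card) :
    ∃ π : Equiv.Perm X, (∀ x, π (π x) = x) ∧ (∀ x, π x ∈ α ↔ x ∈ γ) ∧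
      ∀ x, x ∉ α → x ∉ γ → π x = x := by
  have hcard : (α \ γ).card = (γ \ α).card := by
    have h1 := Finset.card_sdiff_add_card_inter α γ
    have h2 := Finset.card_sdiff_add_card_inter γ α
    rw [Finset.inter_comm] at h2
    omega
  let e := Finset.equivOfCardEq hcard
  let f : X → X := fun x => if hx : x ∈ α \ γ then (e ⟨x, hx⟩ : X)
    else if hx : x ∈ γ \ α then (e.symm ⟨x, hx⟩ : X) else x
  have hf1 : ∀ x (hx : x ∈ α \ γ), f x = e ⟨x, hx⟩ := fun x hx => by
    simp only [f, dif_pos hx]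
  have hf2 : ∀ x (hx : x ∈ γ \ α), f x = e.symm ⟨x, hx⟩ := fun x hx => by
    have : x ∉ α \ γ := by
      simp only [Finset.mem_sdiff] at hx ⊢
      tauto
    simp only [f, dif_neg this, dif_pos hx]
  have hf3 : ∀ x, x ∉ α \ γ → x ∉ γ \ α → f x = x := fun x h1 h2 => by
    simp only [f, dif_neg h1, dif_neg h2]
  have hinv : Function.Involutive f := by
    intro x
    by_cases h1 : x ∈ α \ γ
    · rw [hf1 x h1, hf2 _ (e ⟨x, h1⟩).2]
      simp
    · by_cases h2 : x ∈ γ \ α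
      · rw [hf2 x h2, hf1 _ (e.symm ⟨x, h2⟩).2]
        simp
      · rw [hf3 x h1 h2, hf3 x h1 h2]
  refine ⟨hinv.toPerm, hinv, fun x => ?_, fun x h1 h2 => ?_⟩
  · change f x ∈ α ↔ x ∈ γ
    by_cases h1 : x ∈ α \ γ
    · have h3 := (e ⟨x, h1⟩).2
      rw [← hf1 x h1] at h3
      simp only [Finset.mem_sdiff] at h1 h3
      tauto
    · by_cases h2 : x ∈ γ \ α
      · have h3 := (e.symm ⟨x, h2⟩).2
        rw [← hf2 x h2] at h3
        simp only [Finset.mem_sdiff] at h2 h3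
        tauto
      · rw [hf3 x h1 h2]
        simp only [Finset.mem_sdiff] at h1 h2
        tauto
  · exact hf3 x (by simp [h1]) (by simp [h2])

lemma forall_comp_exchange {α γ : Finset (Fin N)} {π : Equiv.Perm (Fin N)}
    (h1 : ∀ x, π (π x) = x) (h2 : ∀ x, π x ∈ α ↔ x ∈ γ) (z : Fin N → Fin n) (i : Fin n) :
    (∀ s ∈ α, (z ∘ π) s = i) ↔ ∀ s ∈ γ, z s = i := by
  constructor
  · intro h s hs
    have := h (π s) ((h2 s).2 hs)
    rwa [Function.comp_apply, h1] at this
  · intro h s hs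
    exact h _ ((h2 _).1 (by rwa [h1]))

lemma deckCount_forall_eq_of_card_eq {α γ : Finset (Fin N)} (h : α.card = γ.card) (i : Fin n) :
    deckCount m (fun z => ∀ s ∈ α, z s = i) = deckCount m (fun z => ∀ s ∈ γ, z s = i) := by
  obtain ⟨π, h1, h2, -⟩ := exists_involutive_exchange α γ h
  rw [← deckCount_comp_perm π]
  exact deckCount_congr fun z => forall_comp_exchange h1 h2 z i

-- The count is the same for every word of the deck; this is why averaging over `γ` removes the
-- conditioning on a monochromatic set.
open Classical in
lemma sum_powersetCard_univ_boole {z : Fin N → Fin n} (hz : z ∈ deckFinset N m) (r : ℕ)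
    (i : Fin n) :
    (∑ γ ∈ (Finset.univ : Finset (Fin N)).powersetCard r,
      if ∀ s ∈ γ, z s = i then (1 : ℝ) else 0) = (m i).choose r := by
  rw [Finset.sum_boole, ← mem_deckFinset.1 hz i, ← Finset.card_powersetCard]
  congr 2
  ext γ
  simp only [Finset.mem_filter, Finset.mem_powersetCard, Finset.subset_iff, Finset.mem_univ,
    true_and, implies_true]
  tauto

lemma choose_mul_deckCount_forall (α : Finset (Fin N)) (i : Fin n) :
    (N.choose α.card : ℝ) * deckCount m (fun z => ∀ s ∈ α, z s = i) =
      (deckFinset N m).card * ((m i).choose α.card : ℝ) := by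
  classical
  have h1 : (N.choose α.card : ℝ) * deckCount m (fun z => ∀ s ∈ α, z s = i) =
      ∑ γ ∈ (Finset.univ : Finset (Fin N)).powersetCard α.card,
        deckCount m (fun z => ∀ s ∈ γ, z s = i) := by
    rw [Finset.sum_congr rfl fun γ hγ =>
      deckCount_forall_eq_of_card_eq (Finset.mem_powersetCard.1 hγ).2 i]
    simp
  rw [h1]
  simp_rw [deckCount_eq_sum]
  rw [Finset.sum_comm, ← nsmul_eq_mul, ← Finset.sum_const]
  refine Finset.sum_congr rfl fun z hz => ?_
  convert sum_powersetCard_univ_boole hz α.card i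

lemma card_powersetCard_filter_superset_le {X : Type*} [DecidableEq X] (Y S : Finset X) (r : ℕ) :
    ((Y.powersetCard r).filter fun α => S ⊆ α).card ≤ Y.card.choose (r - S.card) := by
  rw [← Finset.card_powersetCard]
  refine Finset.card_le_card_of_injOn (· \ S) (fun α hα => ?_) fun α hα β hβ hab => ?_
  · simp only [Finset.mem_coe, Finset.mem_filter, Finset.mem_powersetCard] at hα ⊢
    exact ⟨Finset.sdiff_subset.trans hα.1.1, by rw [Finset.card_sdiff_of_subset hα.2, hα.1.2]⟩
  · simp only [Finset.mem_coe, Finset.mem_filter] at hα hβ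
    rw [← Finset.sdiff_union_of_subset hα.2, ← Finset.sdiff_union_of_subset hβ.2]
    simp only at hab
    rw [hab]

lemma card_powersetCard_filter_not_disjoint_le {X : Type*} [DecidableEq X] (Y A : Finset X)
    (r : ℕ) :
    ((Y.powersetCard r).filter fun S => ¬ Disjoint A S).card ≤ A.card * Y.card.choose (r - 1) := by
  have hsub : ((Y.powersetCard r).filter fun S => ¬ Disjoint A S) ⊆
      A.biUnion fun a => (Y.powersetCard r).filter fun S => {a} ⊆ S := by
    intro S hS
    simp only [Finset.mem_filter, Finset.not_disjoint_iff] at hS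
    obtain ⟨h1, a, ha, haS⟩ := hS
    simp only [Finset.mem_biUnion, Finset.mem_filter, Finset.singleton_subset_iff]
    exact ⟨a, ha, h1, haS⟩
  refine (Finset.card_le_card hsub).trans (Finset.card_biUnion_le_card_mul _ _ _ fun a _ => ?_)
  simpa using card_powersetCard_filter_superset_le Y {a} r

end Counting

/-! ### The switching and the probability that it disturbs other collisions. -/

section Switching

variable {N n : ℕ}

/-- The positions of the first `t` cards. -/
def firstPos (N t : ℕ) : Finset (Fin N) := Finset.univ.filter fun s => s.val < t

lemma mem_firstPos {t : ℕ} {s : Fin N} : s ∈ firstPos N t ↔ s.val < t := by simp [firstPos]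

lemma firstPos_subset {t T : ℕ} (h : t ≤ T) : firstPos N t ⊆ firstPos N T := fun _ hs =>
  mem_firstPos.2 ((mem_firstPos.1 hs).trans_le h)

lemma card_firstPos_of_le {t : ℕ} (h : t ≤ N) : (firstPos N t).card = t := by
  have := Fin.card_filter_val_lt (n := N) (m := t)
  rw [firstPos, this, min_eq_right h]

/-- All the cards at the positions in `S` have the same type. -/
def Mono (z : Fin N → Fin n) (S : Finset (Fin N)) : Prop := ∀ a ∈ S, ∀ b ∈ S, z a = z b

instance (z : Fin N → Fin n) (S : Finset (Fin N)) : Decidable (Mono z S) := by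
  unfold Mono; infer_instance

lemma W_eq_card_filter_mono (j t : ℕ) (z : Fin N → Fin n) :
    W j t z = (((firstPos N t).powersetCard (j + 1)).filter fun S => Mono z S).card := rfl

/-- This splits a collision by its type, so that switching can act on pairs `(α, i)`. An empty `α`
would be counted once for every type. -/
lemma sum_type_boole_eq {z : Fin N → Fin n} {α : Finset (Fin N)} (hα : α.Nonempty) :
    (∑ i, if ∀ s ∈ α, z s = i then (1 : ℝ) else 0) = if Mono z α then 1 else 0 := by
  obtain ⟨a, ha⟩ := hα
  have h : ∀ i, (∀ s ∈ α, z s = i) ↔ (i = z a ∧ Mono z α) := fun i => by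
    constructor
    · intro h
      exact ⟨(h a ha).symm, fun b hb c hc => by rw [h b hb, h c hc]⟩
    · rintro ⟨rfl, h⟩ s hs
      exact h s hs a ha
  simp only [h]
  by_cases hm : Mono z α <;> simp [hm]

lemma cast_W_eq_sum (j t : ℕ) (z : Fin N → Fin n) :
    (W j t z : ℝ) = ∑ α ∈ (firstPos N t).powersetCard (j + 1),
      ∑ i, if ∀ s ∈ α, z s = i then (1 : ℝ) else 0 := by
  rw [W_eq_card_filter_mono, ← Finset.sum_boole]
  refine Finset.sum_congr rfl fun α hα => (sum_type_boole_eq ?_).symm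
  rw [← Finset.card_pos, (Finset.mem_powersetCard.1 hα).2]
  omega

/-- The vector of the collision counts `W_{j + 1} (t j)`. -/
def collisions {k : ℕ} (t : Fin k → ℕ) (z : Fin N → Fin n) (j : Fin k) : ℕ := W (j.val + 1) (t j) z

/-- Replacing the cards at the positions of a monochromatic set `α` takes away only the collision
`α` itself, unless it produces a new collision that meets `α`, or another card has the type of
`α`, or a part of `α` is itself counted as a smaller collision. -/
lemma collisions_eq_sub_single {k : ℕ} (t : Fin k → ℕ) {T : ℕ} (hT : ∀ j, t j ≤ T) (j : Fin k)
    {z y : Fin N → Fin n} {i : Fin n} {α : Finset (Fin N)}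
    (hα : α ∈ (firstPos N (t j)).powersetCard (j.val + 2)) (hz : ∀ s ∈ α, z s = i)
    (hagree : ∀ s ∈ firstPos N T, s ∉ α → y s = z s)
    (hA : ∀ j' : Fin k, ∀ S ∈ (firstPos N (t j')).powersetCard (j'.val + 2),
      ¬ Disjoint α S → ¬ Mono y S)
    (hB : ∀ x ∈ firstPos N T, x ∉ α → z x ≠ i)
    (hC : ∀ j' : Fin k, j' < j → (α ∩ firstPos N (t j')).card < j'.val + 2) :
    collisions t y = collisions t z - Pi.single j 1 := by
  classical
  rw [Finset.mem_powersetCard] at hα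
  have hαne : α.Nonempty := by rw [← Finset.card_pos, hα.2]; omega
  obtain ⟨a, ha⟩ := hαne
  ext j'
  simp only [collisions, Pi.sub_apply, W_eq_card_filter_mono]
  set X := (firstPos N (t j')).powersetCard (j'.val + 1 + 1) with hX
  have hXT : ∀ S ∈ X, S ⊆ firstPos N T := fun S hS =>
    (Finset.mem_powersetCard.1 hS).1.trans (firstPos_subset (hT j'))
  have hy : (X.filter fun S => Mono y S) = X.filter fun S => Mono z S ∧ Disjoint α S := by
    ext S
    simp only [Finset.mem_filter]
    refine and_congr_right fun hS => ?_
    by_cases hd : Disjoint α S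
    · have hag : ∀ s ∈ S, y s = z s := fun s hs =>
        hagree s (hXT S hS hs) fun h => Finset.disjoint_left.1 hd h hs
      simp only [hd, and_true, Mono]
      exact forall₂_congr fun b hb => forall₂_congr fun c hc => by rw [hag b hb, hag c hc]
    · simp only [hd, and_false, iff_false]
      exact hA j' S hS hd
  -- A monochromatic `S` that meets `α` has type `i`, so `hB` forces it into `α`. Comparing sizes
  -- gives `j' ≤ j`, and `hC` excludes `j' < j`.
  have hmeet : ∀ S ∈ X, Mono z S → ¬ Disjoint α S → S = α ∧ j' = j := by
    intro S hS hm hd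
    obtain ⟨b, hbα, hbS⟩ := Finset.not_disjoint_iff.1 hd
    have hSα : S ⊆ α := fun x hx => by
      by_contra hxα
      exact hB x (hXT S hS hx) hxα ((hm x hx b hbS).trans (hz b hbα))
    have hc := Finset.card_le_card hSα
    have hS' := Finset.mem_powersetCard.1 hS
    rw [hS'.2, hα.2] at hc
    have hle : j' ≤ j := Fin.le_def.2 (by omega)
    rcases hle.lt_or_eq with hlt | heq
    · exfalso
      have h1 := hC j' hlt
      have h2 := Finset.card_le_card (Finset.subset_inter hSα hS'.1)
      rw [hS'.2] at h2
      omega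
    · refine ⟨Finset.eq_of_subset_of_card_le hSα ?_, heq⟩
      rw [hS'.2, hα.2, heq]
  rw [hy]
  by_cases hj : j' = j
  · subst hj
    have hαm : Mono z α := fun b hb c hc => by rw [hz b hb, hz c hc]
    have hαX : α ∈ X := Finset.mem_powersetCard.2 hα
    have : (X.filter fun S => Mono z S ∧ Disjoint α S) = (X.filter fun S => Mono z S).erase α := by
      ext S
      simp only [Finset.mem_filter, Finset.mem_erase]
      constructor
      · rintro ⟨h1, h2, h3⟩
        refine ⟨?_, h1, h2⟩
        rintro rfl
        exact Finset.disjoint_left.1 h3 ha ha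
      · rintro ⟨h1, h2, h3⟩
        refine ⟨h2, h3, ?_⟩
        by_contra hd
        exact h1 (hmeet S h2 h3 hd).1
    rw [this, Finset.card_erase_of_mem (Finset.mem_filter.2 ⟨hαX, hαm⟩), Pi.single_eq_same]
  · rw [Pi.single_eq_of_ne hj, Nat.sub_zero]
    congr 1
    refine Finset.filter_congr fun S hS => ⟨fun h => h.1, fun h => ⟨h, ?_⟩⟩
    by_contra hd
    exact hj (hmeet S hS h hd).2

variable {m : Fin n → ℕ}

/-- Given that the cards at `γ` have type `i`, the expected number of collisions in a set of `t`
positions that meet `α` is small. -/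
lemma deckCount_exists_mono_le {M : ℕ} (hM : ∀ i, m i ≤ M) {ρ : ℝ} {R : ℕ} (hR : (R : ℝ) < N)
    (hρ : (M : ℝ) ≤ ρ * ((N : ℝ) - R)) (hρ0 : 0 ≤ ρ) {t T r : ℕ} (htT : t ≤ T) (htN : t ≤ N)
    (hT1 : T * ρ ≤ 1) (hr : 1 ≤ r) {α γ : Finset (Fin N)} (hγ : Disjoint γ (firstPos N T))
    (hcard : γ.card + (r + 1) ≤ R) (i : Fin n) :
    deckCount m (fun z => (∀ s ∈ γ, z s = i) ∧
      ∃ S ∈ ((firstPos N t).powersetCard (r + 1)).filter (fun S => ¬ Disjoint α S), Mono z S)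
      ≤ α.card * (T * ρ) * deckCount m (fun z => ∀ s ∈ γ, z s = i) := by
  classical
  set q := deckCount m (fun z => ∀ s ∈ γ, z s = i) with hq
  have hq0 : 0 ≤ q := deckCount_nonneg _
  set X := ((firstPos N t).powersetCard (r + 1)).filter (fun S => ¬ Disjoint α S) with hX
  -- One position `a` of `S` chooses the type; each of the other `r` has to match it, at a cost of
  -- `ρ`.
  have hstep : ∀ S ∈ X, deckCount m (fun z => (∀ s ∈ γ, z s = i) ∧ Mono z S) ≤ ρ ^ r * q := by
    intro S hS
    have hS' := Finset.mem_powersetCard.1 (Finset.mem_filter.1 hS).1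
    obtain ⟨a, ha⟩ : S.Nonempty := by rw [← Finset.card_pos, hS'.2]; omega
    have hdis : Disjoint γ S := hγ.mono_right (hS'.1.trans (firstPos_subset htT))
    have haγ : a ∉ γ := fun h => Finset.disjoint_left.1 hdis h ha
    have := deckCount_and_forall_le (m := m) hM hR hρ (insert a γ) (fun z => ∀ s ∈ γ, z s = i)
      (fun z => z a)
      (fun z z' h => forall₂_congr fun s hs => by rw [h s (Finset.mem_insert_of_mem hs)])
      (fun z z' h => h a (Finset.mem_insert_self _ _)) (S.erase a)
      (Finset.disjoint_insert_left.2 ⟨Finset.notMem_erase _ _,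
        hdis.mono_right (Finset.erase_subset _ _)⟩)
      (by rw [Finset.card_insert_of_notMem haγ, Finset.card_erase_of_mem ha, hS'.2]; omega)
    rw [Finset.card_erase_of_mem ha, hS'.2, Nat.add_sub_cancel] at this
    refine (deckCount_mono fun z hz => ?_).trans this
    exact ⟨hz.1, fun s hs => hz.2 s (Finset.mem_of_mem_erase hs) a ha⟩
  have hXcard : (X.card : ℝ) ≤ α.card * (T : ℝ) ^ r := by
    have h1 := card_powersetCard_filter_not_disjoint_le (firstPos N t) α (r + 1)
    rw [card_firstPos_of_le htN, Nat.add_sub_cancel] at h1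
    have h2 : X.card ≤ α.card * T ^ r :=
      h1.trans (Nat.mul_le_mul_left _ ((Nat.choose_le_pow _ _).trans (Nat.pow_le_pow_left htT _)))
    exact_mod_cast h2
  have hpow : (T * ρ) ^ r ≤ T * ρ := by
    have := pow_le_pow_of_le_one (by positivity : 0 ≤ T * ρ) hT1 hr
    simpa using this
  calc _ ≤ deckCount m (fun z => ∃ S ∈ X, (∀ s ∈ γ, z s = i) ∧ Mono z S) :=
        deckCount_mono fun z hz => by
          obtain ⟨h1, S, hS, h2⟩ := hz
          exact ⟨S, hS, h1, h2⟩
    _ ≤ ∑ S ∈ X, deckCount m (fun z => (∀ s ∈ γ, z s = i) ∧ Mono z S) := deckCount_exists_le _ _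
    _ ≤ ∑ _S ∈ X, ρ ^ r * q := Finset.sum_le_sum hstep
    _ = X.card * (ρ ^ r * q) := by simp
    _ ≤ α.card * (T : ℝ) ^ r * (ρ ^ r * q) := by gcongr
    _ = α.card * (T * ρ) ^ r * q := by rw [mul_pow]; ring
    _ ≤ α.card * (T * ρ) * q := by gcongr

/-- Some smaller collision is already contained in the early part of `α`. -/
def Crowded {k : ℕ} (t : Fin k → ℕ) (j : Fin k) (α : Finset (Fin N)) : Prop :=
  ∃ j' : Fin k, j' < j ∧ j'.val + 2 ≤ (α ∩ firstPos N (t j')).card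

open Classical in
/-- The switching that moves a monochromatic set `α` out of sight is unlikely to change the
collision counts otherwise. -/
lemma deckCount_collisions_ne_le {M : ℕ} (hM : ∀ i, m i ≤ M) {k : ℕ} {ρ : ℝ}
    (hR : ((2 * k + 2 : ℕ) : ℝ) < N) (hρ : (M : ℝ) ≤ ρ * ((N : ℝ) - (2 * k + 2 : ℕ)))
    (hρ0 : 0 ≤ ρ) (t : Fin k → ℕ) {T : ℕ} (hT : ∀ j, t j ≤ T) (hTN : T ≤ N) (hT1 : T * ρ ≤ 1)
    (j : Fin k) {α γ : Finset (Fin N)}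
    (hα : α ∈ (firstPos N (t j)).powersetCard (j.val + 2)) (hγc : γ.card = j.val + 2)
    (hγ : Disjoint γ (firstPos N T)) {π : Equiv.Perm (Fin N)} (h1 : ∀ x, π (π x) = x)
    (h2 : ∀ x, π x ∈ α ↔ x ∈ γ) (h3 : ∀ x, x ∉ α → x ∉ γ → π x = x) (i : Fin n) :
    deckCount m (fun z => (∀ s ∈ α, z s = i) ∧
      collisions t (z ∘ π) ≠ collisions t z - Pi.single j 1)
      ≤ (((k : ℝ) * (k + 1) + 1) * (T * ρ) + if Crowded t j α then 1 else 0) *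
        deckCount m (fun z => ∀ s ∈ α, z s = i) := by
  have hα' := Finset.mem_powersetCard.1 hα
  set q := deckCount m (fun z => ∀ s ∈ α, z s = i) with hq
  have hq0 : 0 ≤ q := deckCount_nonneg _
  have hqγ : deckCount m (fun z => ∀ s ∈ γ, z s = i) = q :=
    deckCount_forall_eq_of_card_eq (by rw [hγc, hα'.2]) i
  have hjk : (j.val : ℝ) + 2 ≤ k + 1 := by exact_mod_cast (by omega : j.val + 2 ≤ k + 1)
  by_cases hC : Crowded t j α
  · rw [if_pos hC]
    calc _ ≤ 1 * q := by rw [one_mul]; exact deckCount_mono fun z hz => hz.1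
      _ ≤ _ := by
        gcongr
        have : 0 ≤ ((k : ℝ) * (k + 1) + 1) * (T * ρ) := by positivity
        linarith
  rw [if_neg hC, add_zero]
  -- The two ways to fail: `PA` is a collision that meets `α` in the switched word, a word with `γ`
  -- of type `i`; `PB` is another early card of type `i` in the original word.
  set PA : Fin k → (Fin N → Fin n) → Prop := fun j' z => (∀ s ∈ γ, z s = i) ∧
    ∃ S ∈ ((firstPos N (t j')).powersetCard (j'.val + 1 + 1)).filter (fun S => ¬ Disjoint α S),
      Mono z S with hPA
  set PB : (Fin N) → (Fin N → Fin n) → Prop := fun x z => (∀ s ∈ α, z s = i) ∧ z x = i with hPB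
  have hsplit : ∀ z : Fin N → Fin n, ((∀ s ∈ α, z s = i) ∧
      collisions t (z ∘ π) ≠ collisions t z - Pi.single j 1) →
      ((∃ j' ∈ (Finset.univ : Finset (Fin k)), PA j' (z ∘ π)) ∨
        ∃ x ∈ firstPos N T \ α, PB x z) := by
    rintro z ⟨hz, hne⟩
    by_contra hcon
    push Not at hcon
    obtain ⟨hA, hB⟩ := hcon
    refine hne (collisions_eq_sub_single t hT j hα hz (fun s hs hsα => ?_) (fun j' S hS hd hm => ?_)
      (fun x hx hxα hzx => ?_) fun j' hj' => ?_)
    · rw [Function.comp_apply, h3 s hsα fun h => Finset.disjoint_left.1 hγ h hs]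
    · refine hA j' (Finset.mem_univ _) ⟨?_, S, Finset.mem_filter.2 ⟨hS, hd⟩, hm⟩
      rw [← forall_comp_exchange h1 h2]
      simpa [Function.comp_def, h1] using hz
    · exact hB x (Finset.mem_sdiff.2 ⟨hx, hxα⟩) ⟨hz, hzx⟩
    · by_contra h
      exact hC ⟨j', hj', not_lt.1 h⟩
  have hA : ∀ j', deckCount m (fun z => PA j' (z ∘ π)) ≤ (k + 1) * (T * ρ) * q := by
    intro j'
    rw [deckCount_comp_perm π]
    have := deckCount_exists_mono_le hM hR hρ hρ0 (hT j') ((hT j').trans hTN) hT1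
      (r := j'.val + 1) (by omega) (α := α) hγ (by omega) i
    rw [hqγ] at this
    refine this.trans ?_
    rw [hα'.2]
    push_cast
    gcongr
  have hB : ∀ x ∈ firstPos N T \ α, deckCount m (PB x) ≤ ρ * q := by
    intro x hx
    have := deckCount_and_forall_le (m := m) hM hR hρ α (fun z => ∀ s ∈ α, z s = i)
      (fun _ => i) (fun z z' h => forall₂_congr fun s hs => by rw [h s hs]) (fun _ _ _ => rfl) {x}
      (Finset.disjoint_singleton_right.2 (Finset.mem_sdiff.1 hx).2)
      (by rw [hα'.2, Finset.card_singleton]; omega)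
    simpa [hPB] using this
  have hcardB : ((firstPos N T \ α).card : ℝ) ≤ T := by
    have := Finset.card_le_card (Finset.sdiff_subset (s := firstPos N T) (t := α))
    rw [card_firstPos_of_le hTN] at this
    exact_mod_cast this
  calc _ ≤ deckCount m (fun z => (∃ j' ∈ (Finset.univ : Finset (Fin k)), PA j' (z ∘ π)) ∨
        ∃ x ∈ firstPos N T \ α, PB x z) := deckCount_mono hsplit
    _ ≤ (∑ j', deckCount m (fun z => PA j' (z ∘ π))) +
        ∑ x ∈ firstPos N T \ α, deckCount m (PB x) :=
      (deckCount_or_le _ _).trans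
        (add_le_add (deckCount_exists_le _ fun j' z => PA j' (z ∘ π)) (deckCount_exists_le _ _))
    _ ≤ (∑ _j' : Fin k, (k + 1) * (T * ρ) * q) + ∑ _x ∈ firstPos N T \ α, ρ * q :=
      add_le_add (Finset.sum_le_sum fun j' _ => hA j') (Finset.sum_le_sum hB)
    _ = k * ((k + 1) * (T * ρ) * q) + (firstPos N T \ α).card * (ρ * q) := by simp
    _ ≤ k * ((k + 1) * (T * ρ) * q) + T * (ρ * q) := by gcongr
    _ = _ := by ring

end Switching

/-! ### The Stein identity for the collision counts. -/

section Identity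

variable {N n : ℕ} {m : Fin n → ℕ}

-- The exchange is a bijection from the words with `α` of type `i` to those with `γ` of type `i`.
open Classical in
lemma sum_deckFinset_exchange {α γ : Finset (Fin N)} {π : Equiv.Perm (Fin N)}
    (h1 : ∀ x, π (π x) = x) (h2 : ∀ x, π x ∈ α ↔ x ∈ γ) (i : Fin n)
    (φ : (Fin N → Fin n) → ℝ) :
    ∑ z ∈ deckFinset N m, (if ∀ s ∈ γ, z s = i then (1 : ℝ) else 0) * φ z =
      ∑ z ∈ deckFinset N m, (if ∀ s ∈ α, z s = i then (1 : ℝ) else 0) * φ (z ∘ π) := by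
  rw [← sum_deckFinset_comp_perm π]
  refine Finset.sum_congr rfl fun z _ => ?_
  have h : (∀ s ∈ γ, (z ∘ π) s = i) ↔ ∀ s ∈ α, z s = i := by
    rw [← forall_comp_exchange h1 h2]
    simp [h1]
  simp only [h]

lemma abs_sum_boole_mul_le (P : (Fin N → Fin n) → Prop) [DecidablePred P] (φ : (Fin N → Fin n) → ℝ) {B : ℝ}
    (hφ : ∀ z, |φ z| ≤ B) :
    |∑ z ∈ deckFinset N m, (if P z then (1 : ℝ) else 0) * φ z| ≤ B * deckCount m P := by
  have hP : deckCount m P = ∑ z ∈ deckFinset N m, if P z then (1 : ℝ) else 0 := by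
    rw [deckCount_eq_sum]
    exact Finset.sum_congr rfl fun z _ => by congr
  rw [hP, Finset.mul_sum]
  refine (Finset.abs_sum_le_sum_abs _ _).trans (Finset.sum_le_sum fun z _ => ?_)
  by_cases h : P z
  · simpa [h] using hφ z
  · simp [h]

open Classical in
/-- The Stein identity for one potential collision `α` of type `i`. -/
lemma abs_choose_mul_sum_sub_le {M : ℕ} (hM : ∀ i, m i ≤ M) (hM1 : 1 ≤ M) {k : ℕ} {ρ : ℝ}
    (hR : ((2 * k + 2 : ℕ) : ℝ) < N) (hρ : (M : ℝ) ≤ ρ * ((N : ℝ) - (2 * k + 2 : ℕ)))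
    (hρ0 : 0 ≤ ρ) (t : Fin k → ℕ) {T : ℕ} (hT : ∀ j, t j ≤ T) (hTN : T ≤ N) (hT1 : T * ρ ≤ 1)
    (j : Fin k) {α : Finset (Fin N)} (hα : α ∈ (firstPos N (t j)).powersetCard (j.val + 2))
    (i : Fin n) (F : (Fin k → ℕ) → ℝ) (hF : ∀ u, |F u| ≤ 2) :
    |(N.choose (j.val + 2) : ℝ) * (∑ z ∈ deckFinset N m, (if ∀ s ∈ α, z s = i then (1 : ℝ) else 0) *
        F (collisions t z - Pi.single j 1)) -
      (m i).choose (j.val + 2) * ∑ z ∈ deckFinset N m, F (collisions t z)| ≤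
    (N.choose (j.val + 2) : ℝ) *
      (4 * ((((k : ℝ) + 1) * (k + 1) + 1) * (T * ρ) + if Crowded t j α then 1 else 0) *
        deckCount m (fun z => ∀ s ∈ α, z s = i)) := by
  have hα' := Finset.mem_powersetCard.1 hα
  set r := j.val + 2 with hr
  have hrk : r ≤ k + 1 := by omega
  set q := deckCount m (fun z => ∀ s ∈ α, z s = i) with hq
  have hq0 : 0 ≤ q := deckCount_nonneg _
  set G := (Finset.univ : Finset (Fin N)).powersetCard r with hG
  have hGcard : (G.card : ℝ) = N.choose r := by simp [hG]
  set c : ℝ := (((k : ℝ) * (k + 1) + 1) * (T * ρ) + if Crowded t j α then 1 else 0) with hc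
  have hc0 : 0 ≤ c := by
    rw [hc]
    have : (0 : ℝ) ≤ if Crowded t j α then 1 else 0 := by split_ifs <;> norm_num
    positivity
  set A := ∑ z ∈ deckFinset N m, (if ∀ s ∈ α, z s = i then (1 : ℝ) else 0) *
        F (collisions t z - Pi.single j 1) with hA
  set B : Finset (Fin N) → ℝ := fun γ =>
    ∑ z ∈ deckFinset N m, (if ∀ s ∈ γ, z s = i then (1 : ℝ) else 0) * F (collisions t z) with hB
  have hBsum : (m i).choose r * ∑ z ∈ deckFinset N m, F (collisions t z) = ∑ γ ∈ G, B γ := by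
    rw [hB, Finset.sum_comm, Finset.mul_sum]
    refine Finset.sum_congr rfl fun z hz => ?_
    rw [← Finset.sum_mul]
    congr 1
    rw [← sum_powersetCard_univ_boole hz r i]
  have hAsum : (N.choose r : ℝ) * A = ∑ _γ ∈ G, A := by
    rw [Finset.sum_const, nsmul_eq_mul, hGcard]
  rw [hBsum, hAsum, ← Finset.sum_sub_distrib]
  -- If `γ` avoids the first `T` positions, the switching applies and `|F| ≤ 2` bounds each changed
  -- term by 4. Otherwise both sums are bounded trivially by `2 * q`.
  have hterm : ∀ γ ∈ G, |A - B γ| ≤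
      4 * c * q + if ¬ Disjoint (firstPos N T) γ then 4 * q else 0 := by
    intro γ hγ
    have hγc := (Finset.mem_powersetCard.1 hγ).2
    by_cases hd : Disjoint (firstPos N T) γ
    · rw [if_neg (not_not.2 hd), add_zero]
      obtain ⟨π, h1, h2, h3⟩ := exists_involutive_exchange α γ (by rw [hγc, hα'.2])
      have key := deckCount_collisions_ne_le hM hR hρ hρ0 t hT hTN hT1 j hα hγc hd.symm h1 h2 h3 i
      have hAB : A - B γ = ∑ z ∈ deckFinset N m,
          (if (∀ s ∈ α, z s = i) ∧ collisions t (z ∘ π) ≠ collisions t z - Pi.single j 1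
            then (1 : ℝ) else 0) *
          (F (collisions t z - Pi.single j 1) - F (collisions t (z ∘ π))) := by
        rw [hA, hB]
        simp only
        rw [sum_deckFinset_exchange h1 h2, ← Finset.sum_sub_distrib]
        refine Finset.sum_congr rfl fun z _ => ?_
        by_cases hz : ∀ s ∈ α, z s = i
        · by_cases hw : collisions t (z ∘ π) = collisions t z - Pi.single j 1
          · simp [hw]
          · rw [if_pos hz, if_pos (And.intro hz hw)]
            ring
        · simp [hz]
      rw [hAB]
      refine (abs_sum_boole_mul_le _ _ (B := 4) fun z => ?_).trans ?_
      · have b1 := hF (collisions t z - Pi.single j 1)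
        have b2 := hF (collisions t (z ∘ π))
        exact (abs_sub _ _).trans (by linarith)
      · rw [mul_assoc]
        gcongr
    · rw [if_pos hd]
      have e1 : |A| ≤ 2 * q := abs_sum_boole_mul_le _ _ fun z => hF _
      have e2 : |B γ| ≤ 2 * q := by
        have := abs_sum_boole_mul_le (m := m) (fun z : Fin N → Fin n => ∀ s ∈ γ, z s = i)
          (fun z => F (collisions t z)) fun z => hF _
        rwa [deckCount_forall_eq_of_card_eq (by rw [hγc, hα'.2] : γ.card = α.card)] at this
      have e3 : 0 ≤ 4 * c * q := by positivity
      linarith [abs_sub A (B γ)]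
  -- Only a fraction `(k + 1) * (T * ρ)` of the sets `γ` meets the first `T` positions; `1 ≤ M` is
  -- what turns `1 / (N - r + 1)` into at most `ρ`.
  have hbad : (((G.filter fun γ => ¬ Disjoint (firstPos N T) γ).card : ℕ) : ℝ) ≤
      (k + 1) * (T * ρ) * N.choose r := by
    have e1 := card_powersetCard_filter_not_disjoint_le (Finset.univ : Finset (Fin N))
      (firstPos N T) r
    rw [card_firstPos_of_le hTN, Finset.card_univ, Fintype.card_fin] at e1
    have hRN : 2 * k + 2 < N := by exact_mod_cast hR
    have e2 : (N.choose r : ℝ) * r = N.choose (r - 1) * ((N : ℝ) - (r - 1 : ℕ)) := by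
      have := Nat.choose_succ_right_eq N (r - 1)
      rw [show r - 1 + 1 = r by omega] at this
      rw [← Nat.cast_sub (by omega)]
      exact_mod_cast this
    have e3 : (N : ℝ) - (2 * k + 2 : ℕ) ≤ (N : ℝ) - (r - 1 : ℕ) := by
      have : ((r - 1 : ℕ) : ℝ) ≤ (2 * k + 2 : ℕ) := by exact_mod_cast (by omega)
      linarith
    have e4 : (1 : ℝ) ≤ ρ * ((N : ℝ) - (r - 1 : ℕ)) := by
      have : (1 : ℝ) ≤ M := by exact_mod_cast hM1
      exact this.trans (hρ.trans (by gcongr))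
    have e5 : (N.choose (r - 1) : ℝ) ≤ ρ * (N.choose r * r) := by
      rw [e2]
      calc (N.choose (r - 1) : ℝ) = N.choose (r - 1) * 1 := by ring
        _ ≤ N.choose (r - 1) * (ρ * ((N : ℝ) - (r - 1 : ℕ))) := by gcongr
        _ = _ := by ring
    have e6 : (r : ℝ) ≤ k + 1 := by exact_mod_cast hrk
    calc _ ≤ (T : ℝ) * N.choose (r - 1) := by exact_mod_cast e1
      _ ≤ T * (ρ * (N.choose r * (k + 1))) := by
        gcongr
        exact e5.trans (by gcongr)
      _ = _ := by ring
  calc |∑ γ ∈ G, (A - B γ)| ≤ ∑ γ ∈ G, |A - B γ| := Finset.abs_sum_le_sum_abs _ _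
    _ ≤ ∑ γ ∈ G, (4 * c * q + if ¬ Disjoint (firstPos N T) γ then 4 * q else 0) :=
      Finset.sum_le_sum hterm
    _ = N.choose r * (4 * c * q) +
        (G.filter fun γ => ¬ Disjoint (firstPos N T) γ).card * (4 * q) := by
      rw [Finset.sum_add_distrib, Finset.sum_const, nsmul_eq_mul, hGcard, ← Finset.sum_filter,
        Finset.sum_const, nsmul_eq_mul]
    _ ≤ N.choose r * (4 * c * q) + (k + 1) * (T * ρ) * N.choose r * (4 * q) := by gcongr
    _ = _ := by rw [hc]; ring

/-- The expected number of monochromatic sets of `r` cards among the first `t` cards. -/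
noncomputable def collisionMean (N : ℕ) (m : Fin n → ℕ) (r t : ℕ) : ℝ :=
  t.choose r * (∑ i, ((m i).choose r : ℝ)) / N.choose r

lemma collisionMean_nonneg (r t : ℕ) : 0 ≤ collisionMean N m r t := by
  unfold collisionMean
  positivity

lemma deckCount_forall_eq {r : ℕ} (hr : r ≤ N) {α : Finset (Fin N)} (hα : α.card = r)
    (i : Fin n) : deckCount m (fun z => ∀ s ∈ α, z s = i) =
      (deckFinset N m).card * ((m i).choose r / N.choose r : ℝ) := by
  have h := choose_mul_deckCount_forall (m := m) α i
  rw [hα] at h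
  have : (N.choose r : ℝ) ≠ 0 := by exact_mod_cast (Nat.choose_pos hr).ne'
  field_simp
  linarith

lemma sum_deckCount_forall_eq {r t : ℕ} (hr : r ≤ N) (ht : t ≤ N) :
    ∑ α ∈ (firstPos N t).powersetCard r, ∑ i, deckCount m (fun z => ∀ s ∈ α, z s = i) =
      (deckFinset N m).card * collisionMean N m r t := by
  rw [Finset.sum_congr rfl fun α hα => Finset.sum_congr rfl fun i _ =>
    deckCount_forall_eq hr (Finset.mem_powersetCard.1 hα).2 i]
  rw [Finset.sum_const, Finset.card_powersetCard, card_firstPos_of_le ht, nsmul_eq_mul,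
    ← Finset.mul_sum, ← Finset.sum_div, collisionMean]
  ring

open Classical in
/-- The expected number of collisions that contain a smaller collision is small. -/
lemma sum_crowded_le {M : ℕ} (hM : ∀ i, m i ≤ M) {k : ℕ} {ρ : ℝ}
    (hR : ((2 * k + 2 : ℕ) : ℝ) < N) (hρ : (M : ℝ) ≤ ρ * ((N : ℝ) - (2 * k + 2 : ℕ)))
    (hρ0 : 0 ≤ ρ) (t : Fin k → ℕ) {T : ℕ} (hT : ∀ j, t j ≤ T) (hTN : T ≤ N) (hT1 : T * ρ ≤ 1)
    {Λ : ℝ} (hΛ : ∀ j : Fin k, collisionMean N m (j.val + 2) (t j) ≤ Λ) (j : Fin k) :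
    ∑ α ∈ (firstPos N (t j)).powersetCard (j.val + 2), ∑ i,
      (if Crowded t j α then (1 : ℝ) else 0) * deckCount m (fun z => ∀ s ∈ α, z s = i) ≤
      (deckFinset N m).card * (k * Λ * (T * ρ)) := by
  have hRN : 2 * k + 2 < N := by exact_mod_cast hR
  set q : Finset (Fin N) → ℝ := fun α => ∑ i, deckCount m (fun z => ∀ s ∈ α, z s = i) with hq
  have hq0 : ∀ α, 0 ≤ q α := fun α => Finset.sum_nonneg fun i _ => deckCount_nonneg _
  set X := (firstPos N (t j)).powersetCard (j.val + 2) with hX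
  set S : Fin k → Finset (Finset (Fin N)) := fun j' =>
    (firstPos N (t j')).powersetCard (j'.val + 2) with hS
  have hΛ0 : 0 ≤ Λ := (collisionMean_nonneg _ _).trans (hΛ j)
  -- A crowded `α` contains some `σ` of the size and range of a smaller collision. Given `σ` of type
  -- `i`, each further card of `α` costs `ρ`, and there are at most `T ^ (j - j')` extensions of
  -- `σ`, so the total gains a factor `T * ρ`.
  have hpoint : ∀ α ∈ X, ∑ i, (if Crowded t j α then (1 : ℝ) else 0) *
      deckCount m (fun z => ∀ s ∈ α, z s = i) ≤
      ∑ j' ∈ Finset.univ.filter (· < j), ∑ σ ∈ S j', if σ ⊆ α then q α else 0 := by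
    intro α hα
    rw [← Finset.mul_sum]
    have hnn : ∀ j' : Fin k, 0 ≤ ∑ σ ∈ S j', if σ ⊆ α then q α else 0 := fun j' =>
      Finset.sum_nonneg fun σ _ => by split_ifs; exacts [hq0 α, le_rfl]
    by_cases hC : Crowded t j α
    · rw [if_pos hC, one_mul]
      obtain ⟨j', hj', hcard⟩ := hC
      obtain ⟨σ, hσ, hσc⟩ := Finset.exists_subset_card_eq hcard
      refine le_trans ?_ (Finset.single_le_sum (fun j' _ => hnn j')
        (Finset.mem_filter.2 ⟨Finset.mem_univ j', hj'⟩))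
      have hσS : σ ∈ S j' :=
        Finset.mem_powersetCard.2 ⟨hσ.trans Finset.inter_subset_right, hσc⟩
      refine le_trans ?_ (Finset.single_le_sum
        (fun σ _ => by split_ifs; exacts [hq0 α, le_rfl]) hσS)
      rw [if_pos (hσ.trans Finset.inter_subset_left)]
    · rw [if_neg hC, zero_mul]
      exact Finset.sum_nonneg fun j' _ => hnn j'
  have hext : ∀ j' : Fin k, j' < j → ∀ σ ∈ S j', ∀ α ∈ X, σ ⊆ α →
      q α ≤ ρ ^ (j.val - j'.val) * q σ := by
    intro j' hj' σ hσ α hα hsub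
    have hj'' : j'.val < j.val := hj'
    have hσc := (Finset.mem_powersetCard.1 hσ).2
    have hαc := (Finset.mem_powersetCard.1 hα).2
    simp only [hq]
    rw [Finset.mul_sum]
    refine Finset.sum_le_sum fun i _ => ?_
    have hdc : (α \ σ).card = j.val - j'.val := by
      rw [Finset.card_sdiff_of_subset hsub, hαc, hσc]; omega
    have := deckCount_and_forall_le (m := m) hM hR hρ σ (fun z => ∀ s ∈ σ, z s = i)
      (fun _ => i) (fun z z' h => forall₂_congr fun s hs => by rw [h s hs]) (fun _ _ _ => rfl)
      (α \ σ) Finset.disjoint_sdiff (by rw [hdc, hσc]; omega)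
    rw [hdc] at this
    refine (deckCount_mono fun z hz => ?_).trans this
    exact ⟨fun s hs => hz s (hsub hs), fun s hs => hz s (Finset.sdiff_subset hs)⟩
  have hσsum : ∀ j' : Fin k, j' < j → ∀ σ ∈ S j',
      (∑ α ∈ X, if σ ⊆ α then q α else 0) ≤ T * ρ * q σ := by
    intro j' hj' σ hσ
    have hj'' : j'.val < j.val := hj'
    have hσc := (Finset.mem_powersetCard.1 hσ).2
    have hc := card_powersetCard_filter_superset_le (firstPos N (t j)) σ (j.val + 2)
    rw [card_firstPos_of_le ((hT j).trans hTN), hσc,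
      show j.val + 2 - (j'.val + 2) = j.val - j'.val by omega] at hc
    have hc' : ((X.filter fun α => σ ⊆ α).card : ℝ) ≤ (T : ℝ) ^ (j.val - j'.val) := by
      exact_mod_cast hc.trans ((Nat.choose_le_pow _ _).trans (Nat.pow_le_pow_left (hT j) _))
    have hpow : (T * ρ) ^ (j.val - j'.val) ≤ T * ρ := by
      have := pow_le_pow_of_le_one (by positivity : 0 ≤ T * ρ) hT1
        (show 1 ≤ j.val - j'.val by omega)
      simpa using this
    have hqσ := hq0 σ
    rw [← Finset.sum_filter]
    calc _ ≤ ∑ _α ∈ X.filter (fun α => σ ⊆ α), ρ ^ (j.val - j'.val) * q σ :=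
          Finset.sum_le_sum fun α hα => hext j' hj' σ hσ α (Finset.mem_filter.1 hα).1
            (Finset.mem_filter.1 hα).2
      _ = (X.filter fun α => σ ⊆ α).card * (ρ ^ (j.val - j'.val) * q σ) := by simp
      _ ≤ (T : ℝ) ^ (j.val - j'.val) * (ρ ^ (j.val - j'.val) * q σ) := by gcongr
      _ = (T * ρ) ^ (j.val - j'.val) * q σ := by rw [mul_pow]; ring
      _ ≤ _ := by gcongr
  calc _ ≤ ∑ α ∈ X, ∑ j' ∈ Finset.univ.filter (· < j), ∑ σ ∈ S j', if σ ⊆ α then q α else 0 :=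
        Finset.sum_le_sum hpoint
    _ = ∑ j' ∈ Finset.univ.filter (· < j), ∑ σ ∈ S j', ∑ α ∈ X, if σ ⊆ α then q α else 0 := by
      rw [Finset.sum_comm]
      exact Finset.sum_congr rfl fun j' _ => Finset.sum_comm
    _ ≤ ∑ j' ∈ Finset.univ.filter (· < j), ∑ σ ∈ S j', T * ρ * q σ :=
      Finset.sum_le_sum fun j' hj' => Finset.sum_le_sum fun σ hσ =>
        hσsum j' (Finset.mem_filter.1 hj').2 σ hσ
    _ = ∑ j' ∈ Finset.univ.filter (· < j),
        T * ρ * ((deckFinset N m).card * collisionMean N m (j'.val + 2) (t j')) := by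
      refine Finset.sum_congr rfl fun j' _ => ?_
      rw [← Finset.mul_sum, sum_deckCount_forall_eq (by omega) ((hT j').trans hTN)]
    _ ≤ ∑ _j' ∈ Finset.univ.filter (· < j), T * ρ * ((deckFinset N m).card * Λ) :=
      Finset.sum_le_sum fun j' _ => by gcongr; exact hΛ j'
    _ ≤ ∑ _j' : Fin k, T * ρ * ((deckFinset N m).card * Λ) :=
      Finset.sum_le_sum_of_subset_of_nonneg (Finset.subset_univ _) fun _ _ _ => by positivity
    _ = _ := by simp; ring

/-- The Stein identity for the collision counts. -/
theorem abs_sum_collisions_mul_sub_le {M : ℕ} (hM : ∀ i, m i ≤ M) (hM1 : 1 ≤ M) {k : ℕ} {ρ : ℝ}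
    (hR : ((2 * k + 2 : ℕ) : ℝ) < N) (hρ : (M : ℝ) ≤ ρ * ((N : ℝ) - (2 * k + 2 : ℕ)))
    (hρ0 : 0 ≤ ρ) (t : Fin k → ℕ) {T : ℕ} (hT : ∀ j, t j ≤ T) (hTN : T ≤ N) (hT1 : T * ρ ≤ 1)
    {Λ : ℝ} (hΛ : ∀ j : Fin k, collisionMean N m (j.val + 2) (t j) ≤ Λ) (j : Fin k)
    (F : (Fin k → ℕ) → ℝ) (hF : ∀ u, |F u| ≤ 2) :
    |∑ z ∈ deckFinset N m, (collisions t z j * F (collisions t z - Pi.single j 1)) -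
      collisionMean N m (j.val + 2) (t j) * ∑ z ∈ deckFinset N m, F (collisions t z)| ≤
    (deckFinset N m).card * (4 * (((k : ℝ) + 1) * (k + 1) + 1 + k) * Λ * (T * ρ)) := by
  classical
  have hRN : 2 * k + 2 < N := by exact_mod_cast hR
  set r := j.val + 2 with hr
  have hch : (0 : ℝ) < N.choose r := by exact_mod_cast Nat.choose_pos (by omega : r ≤ N)
  set X := (firstPos N (t j)).powersetCard r with hX
  set A : Finset (Fin N) → Fin n → ℝ := fun α i =>
    ∑ z ∈ deckFinset N m, (if ∀ s ∈ α, z s = i then (1 : ℝ) else 0) *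
        F (collisions t z - Pi.single j 1) with hA
  set B := ∑ z ∈ deckFinset N m, F (collisions t z) with hB
  have e1 : ∑ z ∈ deckFinset N m, (collisions t z j * F (collisions t z - Pi.single j 1)) =
      ∑ α ∈ X, ∑ i, A α i := by
    have : ∀ z : Fin N → Fin n, (collisions t z j * F (collisions t z - Pi.single j 1)) =
        ∑ α ∈ X, ∑ i, (if ∀ s ∈ α, z s = i then (1 : ℝ) else 0) *
          F (collisions t z - Pi.single j 1) := fun z => by
      rw [collisions, cast_W_eq_sum, Finset.sum_mul]
      refine Finset.sum_congr rfl fun α _ => ?_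
      rw [Finset.sum_mul]
    rw [Finset.sum_congr rfl fun z _ => this z, Finset.sum_comm]
    exact Finset.sum_congr rfl fun α _ => Finset.sum_comm
  have e2 : collisionMean N m r (t j) * B = ∑ _α ∈ X, ∑ i, ((m i).choose r : ℝ) / N.choose r * B := by
    rw [Finset.sum_const, hX, Finset.card_powersetCard, card_firstPos_of_le ((hT j).trans hTN),
      nsmul_eq_mul, ← Finset.sum_mul, ← Finset.sum_div, collisionMean]
    ring
  have hterm : ∀ α ∈ X, ∀ i, |A α i - ((m i).choose r : ℝ) / N.choose r * B| ≤
      (4 * (((k : ℝ) + 1) * (k + 1) + 1) * (T * ρ)) * deckCount m (fun z => ∀ s ∈ α, z s = i) +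
        4 * ((if Crowded t j α then (1 : ℝ) else 0) *
          deckCount m (fun z => ∀ s ∈ α, z s = i)) := by
    intro α hα i
    have key := abs_choose_mul_sum_sub_le hM hM1 hR hρ hρ0 t hT hTN hT1 j hα i F hF
    refine le_of_mul_le_mul_left ?_ hch
    calc (N.choose r : ℝ) * |A α i - ((m i).choose r : ℝ) / N.choose r * B| =
        |(N.choose r : ℝ) * A α i - (m i).choose r * B| := by
          nth_rw 1 [← abs_of_pos hch]
          rw [← abs_mul, mul_sub]
          congr 2
          field_simp
      _ ≤ _ := key
      _ = _ := by ring
  rw [e1, e2, ← Finset.sum_sub_distrib]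
  have hτ : 0 ≤ T * ρ := by positivity
  calc _ ≤ ∑ α ∈ X, ∑ i, |A α i - ((m i).choose r : ℝ) / N.choose r * B| := by
        refine (Finset.abs_sum_le_sum_abs _ _).trans (Finset.sum_le_sum fun α _ => ?_)
        rw [← Finset.sum_sub_distrib]
        exact Finset.abs_sum_le_sum_abs _ _
    _ ≤ _ := Finset.sum_le_sum fun α hα => Finset.sum_le_sum fun i _ => hterm α hα i
    _ = (4 * (((k : ℝ) + 1) * (k + 1) + 1) * (T * ρ)) *
          ((deckFinset N m).card * collisionMean N m r (t j)) +
        4 * ∑ α ∈ X, ∑ i, (if Crowded t j α then (1 : ℝ) else 0) *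
          deckCount m (fun z => ∀ s ∈ α, z s = i) := by
      rw [← sum_deckCount_forall_eq (by omega) ((hT j).trans hTN)]
      simp only [Finset.sum_add_distrib, ← Finset.mul_sum, hX]
    _ ≤ (4 * (((k : ℝ) + 1) * (k + 1) + 1) * (T * ρ)) * ((deckFinset N m).card * Λ) +
        4 * ((deckFinset N m).card * (k * Λ * (T * ρ))) := by
      gcongr
      · exact hΛ j
      · exact sum_crowded_le hM hR hρ hρ0 t hT hTN hT1 hΛ j
    _ = _ := by ring

end Identity

/-! ### Comparison of the means, and the lower bound for the balance parameter. -/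

section Means

/-- Factor by factor, `(t - i) / t ≤ (N - i) / N`. It makes the exact mean at most the Poisson mean.
-/
lemma descFactorial_mul_pow_le {t N : ℕ} (h : t ≤ N) (r : ℕ) :
    t.descFactorial r * N ^ r ≤ N.descFactorial r * t ^ r := by
  induction r with
  | zero => simp
  | succ r ih =>
    rw [Nat.descFactorial_succ, Nat.descFactorial_succ, pow_succ, pow_succ]
    have h1 : (t - r) * N ≤ (N - r) * t := by
      rw [Nat.sub_mul, Nat.sub_mul, mul_comm t N]
      exact Nat.sub_le_sub_left (Nat.mul_le_mul_left _ h) _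
    calc (t - r) * t.descFactorial r * (N ^ r * N)
        = ((t - r) * N) * (t.descFactorial r * N ^ r) := by ring
      _ ≤ ((N - r) * t) * (N.descFactorial r * t ^ r) := Nat.mul_le_mul h1 ih
      _ = _ := by ring

/-- This is `t (t - 1) ⋯ (t - r + 1) / t ^ r ≥ 1 - r ^ 2 / t` with denominators cleared. -/
lemma pow_mul_sub_le_descFactorial_mul (t r : ℕ) :
    (t : ℝ) ^ r * (t - (r : ℝ) ^ 2) ≤ t.descFactorial r * t := by
  induction r with
  | zero => simp
  | succ r ih =>
    rcases lt_or_ge t r with h | h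
    · have h1 : (t : ℝ) ≤ r := by exact_mod_cast h.le
      have h2 : (t : ℝ) - ((r + 1 : ℕ) : ℝ) ^ 2 ≤ 0 := by
        push_cast
        nlinarith [(Nat.cast_nonneg r : (0 : ℝ) ≤ r)]
      exact (mul_nonpos_of_nonneg_of_nonpos (by positivity) h2).trans (by positivity)
    · rw [Nat.descFactorial_succ]
      push_cast [Nat.cast_sub h]
      have h1 : (0 : ℝ) ≤ (t : ℝ) - r := sub_nonneg.2 (by exact_mod_cast h)
      have h2 := mul_le_mul_of_nonneg_left ih h1
      have h3 : (t : ℝ) ^ (r + 1) * (t - ((r : ℝ) + 1) ^ 2) ≤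
          (t - r) * ((t : ℝ) ^ r * (t - (r : ℝ) ^ 2)) := by
        have : (t - r) * ((t : ℝ) ^ r * (t - (r : ℝ) ^ 2)) -
            (t : ℝ) ^ (r + 1) * (t - ((r : ℝ) + 1) ^ 2) =
            (t : ℝ) ^ r * (r * t + t + r ^ 3) := by ring
        have h4 : (0 : ℝ) ≤ (t : ℝ) ^ r * (r * t + t + r ^ 3) := by positivity
        linarith
      linarith

variable {n : ℕ} {m : Fin n → ℕ}

lemma beta_succ_eq (hn : 0 < n) (hN : 0 < size m) (j : ℕ) :
    beta m (j + 1) = (n : ℝ) ^ j * (∑ i, ((m i).choose (j + 1) : ℝ)) / (size m : ℝ) ^ (j + 1) := by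
  have h1 : (n : ℝ) ≠ 0 := by positivity
  have h2 : (size m : ℝ) ≠ 0 := by positivity
  rw [beta, ← Finset.mul_sum, avgMult, div_pow, pow_succ (n : ℝ)]
  field_simp

lemma poissonMean_eq (hn : 0 < n) (hN : 0 < size m) (j t : ℕ) :
    poissonMean m j t =
      (t : ℝ) ^ (j + 1) * (∑ i, ((m i).choose (j + 1) : ℝ)) / (size m : ℝ) ^ (j + 1) := by
  have h1 : (n : ℝ) ≠ 0 := by positivity
  have h2 : (size m : ℝ) ≠ 0 := by positivity
  rw [poissonMean, beta_succ_eq hn hN]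
  field_simp

lemma collisionMean_le_poissonMean (hn : 0 < n) (hN : 0 < size m) {j t : ℕ}
    (hj : j + 1 ≤ size m) (ht : t ≤ size m) :
    collisionMean (size m) m (j + 1) t ≤ poissonMean m j t := by
  rw [poissonMean_eq hn hN, collisionMean]
  have h0 : (0 : ℝ) ≤ ∑ i, ((m i).choose (j + 1) : ℝ) := by positivity
  have hc : (0 : ℝ) < (size m).choose (j + 1) := by exact_mod_cast Nat.choose_pos hj
  rw [div_le_div_iff₀ hc (by positivity)]
  have h1 : t.choose (j + 1) * size m ^ (j + 1) ≤ (size m).choose (j + 1) * t ^ (j + 1) := by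
    have := descFactorial_mul_pow_le ht (j + 1)
    rw [Nat.descFactorial_eq_factorial_mul_choose, Nat.descFactorial_eq_factorial_mul_choose,
      mul_assoc, mul_assoc] at this
    exact Nat.le_of_mul_le_mul_left this (Nat.factorial_pos _)
  have h2 : (t.choose (j + 1) : ℝ) * (size m : ℝ) ^ (j + 1) ≤
      (size m).choose (j + 1) * (t : ℝ) ^ (j + 1) := by exact_mod_cast h1
  calc _ = (t.choose (j + 1) : ℝ) * (size m : ℝ) ^ (j + 1) * ∑ i, ((m i).choose (j + 1) : ℝ) := by
        ring
    _ ≤ (size m).choose (j + 1) * (t : ℝ) ^ (j + 1) * ∑ i, ((m i).choose (j + 1) : ℝ) := by gcongr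
    _ = _ := by ring

lemma poissonMean_sub_collisionMean_le (hn : 0 < n) (hN : 0 < size m) {j t : ℕ}
    (hj : j + 1 ≤ size m) (ht : 0 < t) :
    poissonMean m j t - collisionMean (size m) m (j + 1) t ≤
      ((j : ℝ) + 1) ^ 2 * ((t : ℝ) ^ j * (∑ i, ((m i).choose (j + 1) : ℝ)) /
        (size m : ℝ) ^ (j + 1)) := by
  rw [poissonMean_eq hn hN, collisionMean]
  set V := ∑ i, ((m i).choose (j + 1) : ℝ) with hV
  have h0 : (0 : ℝ) ≤ V := by positivity
  have hc : (0 : ℝ) < (size m).choose (j + 1) := by exact_mod_cast Nat.choose_pos hj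
  have ht' : (0 : ℝ) < t := by exact_mod_cast ht
  have h1 : (size m).choose (j + 1) * (j + 1).factorial ≤ size m ^ (j + 1) := by
    rw [mul_comm, ← Nat.descFactorial_eq_factorial_mul_choose]
    exact Nat.descFactorial_le_pow _ _
  have h1' : ((size m).choose (j + 1) : ℝ) * (j + 1).factorial ≤ (size m : ℝ) ^ (j + 1) := by
    exact_mod_cast h1
  have h2 : (t : ℝ) ^ j * (t - ((j : ℝ) + 1) ^ 2) ≤ t.choose (j + 1) * (j + 1).factorial := by
    have := pow_mul_sub_le_descFactorial_mul t (j + 1)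
    rw [Nat.descFactorial_eq_factorial_mul_choose] at this
    push_cast at this
    refine le_of_mul_le_mul_right ?_ ht'
    calc _ = (t : ℝ) ^ (j + 1) * (t - ((j : ℝ) + 1) ^ 2) := by ring
      _ ≤ _ := this
      _ = _ := by ring
  have h3 : t.choose (j + 1) * (j + 1).factorial / (size m : ℝ) ^ (j + 1) ≤
      (t.choose (j + 1) : ℝ) / (size m).choose (j + 1) := by
    rw [div_le_div_iff₀ (by positivity) hc]
    calc _ = (t.choose (j + 1) : ℝ) * ((size m).choose (j + 1) * (j + 1).factorial) := by ring
      _ ≤ _ := by gcongr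
  have h4 : (t : ℝ) ^ j * (t - ((j : ℝ) + 1) ^ 2) / (size m : ℝ) ^ (j + 1) * V ≤
      (t.choose (j + 1) : ℝ) / (size m).choose (j + 1) * V :=
    mul_le_mul_of_nonneg_right (le_trans (by gcongr) h3) h0
  calc _ = (t : ℝ) ^ (j + 1) * V / (size m : ℝ) ^ (j + 1) -
        (t.choose (j + 1) : ℝ) / (size m).choose (j + 1) * V := by ring
    _ ≤ (t : ℝ) ^ (j + 1) * V / (size m : ℝ) ^ (j + 1) -
        (t : ℝ) ^ j * (t - ((j : ℝ) + 1) ^ 2) / (size m : ℝ) ^ (j + 1) * V := by gcongr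
    _ = _ := by ring

lemma le_maxMult (i : Fin n) : m i ≤ maxMult m := Finset.le_sup (Finset.mem_univ i)

/-- The discrepancy between the two means is small. -/
lemma abs_collisionMean_sub_poissonMean_le (hn : 0 < n) (hN : 0 < size m) {ε : ℝ} (hε : 0 < ε)
    (havg : ε * (maxMult m : ℝ) ≤ avgMult m) {ρ : ℝ} (hρ : (maxMult m : ℝ) ≤ ρ * size m)
    {j t T : ℕ} (hj1 : 1 ≤ j) (hj : j + 1 ≤ size m) (ht : 0 < t) (htN : t ≤ size m) (htT : t ≤ T)
    (hT1 : T * ρ ≤ 1) :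
    |collisionMean (size m) m (j + 1) t - poissonMean m j t| ≤
      ((j : ℝ) + 1) ^ 2 * ((T * ρ) / ε) := by
  rw [abs_sub_comm, abs_of_nonneg (sub_nonneg.2 (collisionMean_le_poissonMean hn hN hj htN))]
  refine (poissonMean_sub_collisionMean_le hn hN hj ht).trans ?_
  have hN' : (0 : ℝ) < size m := by exact_mod_cast hN
  have hn' : (0 : ℝ) < n := by exact_mod_cast hn
  have hsum : ∑ i, ((m i).choose (j + 1) : ℝ) ≤ n * (maxMult m : ℝ) ^ (j + 1) := by
    calc _ ≤ ∑ _i : Fin n, (maxMult m : ℝ) ^ (j + 1) := Finset.sum_le_sum fun i _ => by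
          exact_mod_cast (Nat.choose_le_pow _ _).trans (Nat.pow_le_pow_left (le_maxMult i) _)
      _ = _ := by simp
  have h1 : (t : ℝ) * (maxMult m / size m) ≤ T * ρ := by
    have : (maxMult m : ℝ) / size m ≤ ρ := (div_le_iff₀ hN').2 hρ
    gcongr
  -- Here the balance assumption enters: `n m* / N = m* / m`.
  have h2 : (n : ℝ) * (maxMult m / size m) ≤ 1 / ε := by
    rw [avgMult, le_div_iff₀ hn'] at havg
    rw [← mul_div_assoc, div_le_div_iff₀ hN' hε]
    linarith
  have h0 : 0 ≤ (t : ℝ) * (maxMult m / size m) := by positivity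
  have h3 : ((t : ℝ) * (maxMult m / size m)) ^ j ≤ T * ρ := by
    have := pow_le_pow_of_le_one h0 (h1.trans hT1) hj1
    rw [pow_one] at this
    exact this.trans h1
  refine mul_le_mul_of_nonneg_left ?_ (by positivity)
  calc _ ≤ (t : ℝ) ^ j * (n * (maxMult m : ℝ) ^ (j + 1)) / (size m : ℝ) ^ (j + 1) := by gcongr
    _ = ((t : ℝ) * (maxMult m / size m)) ^ j * (n * (maxMult m / size m)) := by
      rw [mul_pow, div_pow, pow_succ, pow_succ]
      field_simp
    _ ≤ (T * ρ) * (1 / ε) := by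
      refine mul_le_mul h3 h2 (by positivity) (h0.trans h1)
    _ = _ := by ring

/-- The balance parameter is bounded below. -/
lemma le_beta_succ (hn : 0 < n) {k : ℕ} (hk : 1 ≤ k) {ε : ℝ} (hN : 0 < size m)
    (hmax : k + 1 ≤ maxMult m)
    (hfrac : ε ≤ ((Finset.univ.filter fun i => min (2 * k + 1) (maxMult m) ≤ m i).card : ℝ) / n) :
    min (ε / (2 * (k : ℝ)) ^ (k + 1)) (1 / (2 ^ (k + 1) * ((k + 1).factorial : ℝ))) ≤
      beta m (k + 1) := by
  have hN' : (0 : ℝ) < size m := by exact_mod_cast hN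
  have hn' : (0 : ℝ) < n := by exact_mod_cast hn
  have hk' : (0 : ℝ) < k := by exact_mod_cast hk
  rw [beta_succ_eq hn hN]
  -- If the average is below `2 * k`, at least `ε * n` types have `k + 1` or more cards, each
  -- contributing at least 1 to the sum. Otherwise the truncated differences `m i - k` still sum to
  -- at least half the deck, and the power mean inequality applies to them.
  rcases lt_or_ge (size m : ℝ) (2 * k * n) with h | h
  · refine (min_le_left _ _).trans ?_
    have hsum : ε * n ≤ ∑ i, ((m i).choose (k + 1) : ℝ) := by
      calc ε * n ≤ ((Finset.univ.filter fun i => min (2 * k + 1) (maxMult m) ≤ m i).card : ℝ) :=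
            (le_div_iff₀ hn').1 hfrac
        _ = ∑ i ∈ Finset.univ.filter (fun i => min (2 * k + 1) (maxMult m) ≤ m i), (1 : ℝ) := by
            simp
        _ ≤ ∑ i ∈ Finset.univ.filter (fun i => min (2 * k + 1) (maxMult m) ≤ m i),
            ((m i).choose (k + 1) : ℝ) := Finset.sum_le_sum fun i hi => by
              have h1 := (Finset.mem_filter.1 hi).2
              have h2 : k + 1 ≤ m i := le_trans (le_min (by omega) hmax) h1
              exact_mod_cast Nat.choose_pos h2
        _ ≤ _ := Finset.sum_le_sum_of_subset_of_nonneg (Finset.subset_univ _)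
            fun _ _ _ => by positivity
    rw [div_le_div_iff₀ (by positivity) (by positivity)]
    have hε : 0 ≤ ε ∨ ε < 0 := le_or_gt 0 ε
    rcases hε with hε | hε
    · calc ε * (size m : ℝ) ^ (k + 1) ≤ ε * (2 * k * n) ^ (k + 1) := by gcongr
        _ = (n : ℝ) ^ k * (ε * n) * (2 * k) ^ (k + 1) := by rw [mul_pow _ (n : ℝ)]; ring
        _ ≤ _ := by gcongr
    · exact (mul_nonpos_of_nonpos_of_nonneg hε.le (by positivity)).trans (by positivity)
  · refine (min_le_right _ _).trans ?_
    have hchoose : ∀ i, ((m i - k : ℕ) : ℝ) ^ (k + 1) ≤ (k + 1).factorial * (m i).choose (k + 1) := by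
      intro i
      have := Nat.pow_sub_le_descFactorial (m i) (k + 1)
      rw [Nat.descFactorial_eq_factorial_mul_choose, Nat.add_sub_add_right] at this
      exact_mod_cast this
    have hpm := pow_sum_div_card_le_sum_pow (s := (Finset.univ : Finset (Fin n)))
      (f := fun i => ((m i - k : ℕ) : ℝ)) (fun _ _ => Nat.cast_nonneg _) k
    have hlow : (size m : ℝ) / 2 ≤ ∑ i, ((m i - k : ℕ) : ℝ) := by
      have h1 : ∑ i, ((m i : ℝ) - k) ≤ ∑ i, ((m i - k : ℕ) : ℝ) :=
        Finset.sum_le_sum fun i _ => by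
          rw [sub_le_iff_le_add]
          exact_mod_cast (by omega : m i ≤ m i - k + k)
      have h2 : ∑ i, ((m i : ℝ) - k) = size m - n * k := by
        rw [Finset.sum_sub_distrib, size]
        simp
      rw [h2] at h1
      linarith
    rw [Finset.card_univ, Fintype.card_fin] at hpm
    have h3 : ((size m : ℝ) / 2) ^ (k + 1) / (n : ℝ) ^ k ≤
        (k + 1).factorial * ∑ i, ((m i).choose (k + 1) : ℝ) := by
      calc _ ≤ (∑ i, ((m i - k : ℕ) : ℝ)) ^ (k + 1) / (n : ℝ) ^ k := by gcongr
        _ ≤ _ := hpm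
        _ ≤ _ := by rw [Finset.mul_sum]; exact Finset.sum_le_sum fun i _ => hchoose i
    rw [div_le_iff₀ (by positivity), div_pow, div_le_iff₀ (by positivity)] at h3
    rw [div_le_div_iff₀ (by positivity) (by positivity)]
    linarith

end Means

/-! ### From counting words to laws, and the error in terms of `T / n`. -/

section Laws

variable {n : ℕ} {m : Fin n → ℕ}

lemma coe_deckFinset : (deckFinset (size m) m : Set (Fin (size m) → Fin n)) = decks m := by
  ext z
  simp [deckFinset, decks]

lemma deckFinset_nonempty (m : Fin n → ℕ) : (deckFinset (size m) m).Nonempty := by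
  have e : Fin (size m) ≃ Σ i : Fin n, Fin (m i) := finSigmaFinEquiv.symm
  refine ⟨fun s => (e s).1, mem_deckFinset.2 fun i => ?_⟩
  have h1 : (Finset.univ.filter fun s => (e s).1 = i).card =
      (Finset.univ.filter fun x : Σ i : Fin n, Fin (m i) => x.1 = i).card :=
    Finset.card_equiv e fun s => by simp
  have h2 : (Finset.univ.filter fun x : Σ i : Fin n, Fin (m i) => x.1 = i) =
      Finset.univ.map ⟨Sigma.mk i, sigma_mk_injective⟩ := by
    ext ⟨a, b⟩
    simp only [Finset.mem_filter, Finset.mem_univ, true_and, Finset.mem_map,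
      Function.Embedding.coeFn_mk]
    constructor
    · rintro rfl
      exact ⟨b, rfl⟩
    · rintro ⟨b', hb⟩
      exact (congrArg Sigma.fst hb).symm
  rw [h1, h2, Finset.card_map, Finset.card_univ, Fintype.card_fin]

instance (m : Fin n → ℕ) : IsProbabilityMeasure (shuffled m) := by
  rw [shuffled, ← coe_deckFinset]
  exact isProbabilityMeasure_uniformOn (Finset.finite_toSet _) (deckFinset_nonempty m)

open Classical in
lemma shuffled_real_preimage {Y : Type*} (f : (Fin (size m) → Fin n) → Y) (A : Set Y) :
    (shuffled m).real (f ⁻¹' A) =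
      (∑ z ∈ deckFinset (size m) m, A.indicator 1 (f z)) / (deckFinset (size m) m).card := by
  have h : f ⁻¹' A = ((Finset.univ.filter fun z => f z ∈ A : Finset _) : Set _) := by
    ext z; simp
  rw [h, measureReal_def, shuffled, ← coe_deckFinset, uniformOn_apply_finset, ENNReal.toReal_div,
    ENNReal.toReal_natCast, ENNReal.toReal_natCast, Finset.inter_filter, Finset.inter_univ,
    ← Finset.sum_boole]
  congr 1

lemma W_eq_zero_iff {N : ℕ} (j t : ℕ) (z : Fin N → Fin n) :
    W j t z = 0 ↔ ∀ i, countUpTo z t i ≤ j := by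
  rw [W_eq_card_filter_mono, Finset.card_eq_zero, Finset.filter_eq_empty_iff]
  constructor
  · intro h i
    by_contra hlt
    obtain ⟨S, hS, hSc⟩ := Finset.exists_subset_card_eq (Nat.succ_le_of_lt (not_le.1 hlt))
    have hS' : ∀ s ∈ S, s.val < t ∧ z s = i := fun s hs => by simpa using hS hs
    exact h (Finset.mem_powersetCard.2 ⟨fun s hs => mem_firstPos.2 (hS' s hs).1, hSc⟩)
      fun a ha b hb => by rw [(hS' a ha).2, (hS' b hb).2]
  · intro h S hS hm
    rw [Finset.mem_powersetCard] at hS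
    obtain ⟨a, ha⟩ : S.Nonempty := by rw [← Finset.card_pos, hS.2]; omega
    have h1 := h (z a)
    have h2 : S.card ≤ countUpTo z t (z a) := Finset.card_le_card fun s hs => by
      simp only [Finset.mem_filter, Finset.mem_univ, true_and]
      exact ⟨mem_firstPos.1 (hS.1 hs), hm s hs a ha⟩
    omega

/-- The condition `W j t z = 0` passes to smaller times, so it holds exactly up to its last time.
The assumption `1 ≤ t` rules out the default value 0 of an empty supremum. -/
lemma le_T_iff {N : ℕ} {j t : ℕ} (ht1 : 1 ≤ t) (htN : t ≤ N) (z : Fin N → Fin n) :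
    t ≤ T j z ↔ W j t z = 0 := by
  rw [W_eq_zero_iff, T, Finset.le_sup_iff (by rw [Nat.bot_eq_zero]; omega)]
  constructor
  · rintro ⟨s, hs, hts⟩ i
    refine le_trans (Finset.card_le_card fun x hx => ?_) ((Finset.mem_filter.1 hs).2 i)
    simp only [Finset.mem_filter, Finset.mem_univ, true_and, id] at hx hts ⊢
    exact ⟨hx.1.trans_le hts, hx.2⟩
  · intro h
    exact ⟨t, Finset.mem_filter.2 ⟨Finset.mem_Icc.2 ⟨ht1, htN⟩, h⟩, le_rfl⟩

/-- Poisson approximation of the collision counts, on the scale of `T / n`. -/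
theorem abs_shuffled_real_sub_le (hn : 0 < n) {k : ℕ} {ε : ℝ} (hε : 0 < ε)
    (hmax : 1 ≤ maxMult m) (havg : ε * (maxMult m : ℝ) ≤ avgMult m)
    (t : Fin k → ℕ) (ht : ∀ j, 1 ≤ t j ∧ t j ≤ size m) {T : ℕ} (hT : ∀ j, t j ≤ T)
    (hT1 : 1 ≤ T) (hTN : T ≤ size m) (hTn : (T : ℝ) ≤ ε / (4 * k + 5) * n)
    (lam : Fin k → ℝ) (hlam : ∀ j, lam j = poissonMean m (j.val + 1) (t j))
    (hpos : ∀ j, 0 < lam j) {Λ : ℝ} (hΛ0 : 0 ≤ Λ) (hΛ : ∀ j, lam j ≤ Λ) (A : Set (Fin k → ℕ)) :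
    |(shuffled m).real (collisions t ⁻¹' A) -
        (Measure.pi fun j => poissonMeasure (lam j).toNNReal).real A| ≤
      k * (4 * (((k : ℝ) + 1) * (k + 1) + 1 + k) + 2 * (((k : ℝ) + 1) ^ 2 / ε)) * (1 + Λ) *
        (2 / ε * (T / n)) := by
  have hn' : (0 : ℝ) < n := by exact_mod_cast hn
  have hT1' : (1 : ℝ) ≤ T := by exact_mod_cast hT1
  have hM1 : (1 : ℝ) ≤ maxMult m := by exact_mod_cast hmax
  have hM_N : ε * maxMult m * n ≤ size m := by
    rw [avgMult, le_div_iff₀ hn'] at havg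
    exact havg
  -- As `T ≥ 1`, smallness of `T / n` forces the deck to be large. At most `2 * k + 2` positions
  -- (`γ` and one more set) are ever prescribed, less than half of the deck.
  have hεn : 4 * (k : ℝ) + 5 ≤ ε * n := by
    have h5 : (0 : ℝ) < 4 * k + 5 := by positivity
    rw [div_mul_eq_mul_div, le_div_iff₀ h5] at hTn
    nlinarith
  have hNlow : 4 * (k : ℝ) + 5 ≤ size m := by
    have : ε * n ≤ ε * maxMult m * n := by
      have : ε * n * 1 ≤ ε * n * maxMult m := by gcongr
      linarith
    linarith
  have hNpos : 0 < size m := by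
    have : (0 : ℝ) < size m := by linarith [(Nat.cast_nonneg k : (0 : ℝ) ≤ k)]
    exact_mod_cast this
  have hNnat : 4 * k + 5 ≤ size m := by exact_mod_cast hNlow
  -- Balance gives `m* / N ≤ 1 / (ε * n)`; the factor 2 pays for the positions already prescribed.
  set ρ : ℝ := 2 / (ε * n) with hρdef
  have hρ0 : 0 ≤ ρ := by positivity
  have hR : ((2 * k + 2 : ℕ) : ℝ) < size m := by push_cast; linarith
  have hρ : (maxMult m : ℝ) ≤ ρ * ((size m : ℝ) - (2 * k + 2 : ℕ)) := by
    have h1 : (size m : ℝ) / 2 ≤ (size m : ℝ) - (2 * k + 2 : ℕ) := by push_cast; linarith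
    calc (maxMult m : ℝ) = 2 / (ε * n) * ((ε * maxMult m * n) / 2) := by field_simp
      _ ≤ ρ * ((size m : ℝ) / 2) := by rw [hρdef]; gcongr
      _ ≤ _ := by gcongr
  have hρN : (maxMult m : ℝ) ≤ ρ * size m := hρ.trans (by
    gcongr
    linarith [(Nat.cast_nonneg (2 * k + 2) : (0 : ℝ) ≤ (2 * k + 2 : ℕ))])
  have hτeq : T * ρ = 2 / ε * (T / n) := by rw [hρdef]; field_simp
  have hTρ : T * ρ ≤ 1 := by
    have h5 : (0 : ℝ) < 4 * k + 5 := by positivity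
    rw [hρdef, ← mul_div_assoc, div_le_one (by positivity)]
    rw [div_mul_eq_mul_div, le_div_iff₀ h5] at hTn
    nlinarith [(Nat.cast_nonneg k : (0 : ℝ) ≤ k)]
  set D := deckFinset (size m) m with hD
  have hDpos : (0 : ℝ) < D.card := by exact_mod_cast (deckFinset_nonempty m).card_pos
  have hmean : ∀ j : Fin k, collisionMean (size m) m (j.val + 2) (t j) ≤ Λ := fun j =>
    (collisionMean_le_poissonMean hn hNpos (j := j.val + 1) (by omega) (ht j).2).trans
      ((hlam j).symm.le.trans (hΛ j))
  set K : ℝ := 4 * (((k : ℝ) + 1) * (k + 1) + 1 + k) + 2 * (((k : ℝ) + 1) ^ 2 / ε) with hK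
  have herr : ∀ j : Fin k, ∀ F : (Fin k → ℕ) → ℝ, (∀ u, |F u| ≤ 2) →
      |∑ z ∈ D, (collisions t z j * F (collisions t z - Pi.single j 1)) -
        (lam j).toNNReal * ∑ z ∈ D, F (collisions t z)| ≤
        D.card * (K * (1 + Λ) * (T * ρ)) := by
    intro j F hF
    rw [Real.coe_toNNReal _ (hpos j).le]
    have e1 := abs_sum_collisions_mul_sub_le (fun i => le_maxMult (m := m) i) hmax hR hρ hρ0 t hT
      hTN hTρ hmean j F hF
    have e2 := abs_collisionMean_sub_poissonMean_le hn hNpos hε havg hρN (j := j.val + 1)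
      (by omega) (by omega) (ht j).1 (ht j).2 (hT j) hTρ
    rw [← hlam j] at e2
    have e3 : |∑ z ∈ D, F (collisions t z)| ≤ 2 * D.card := by
      refine (Finset.abs_sum_le_sum_abs _ _).trans
        ((Finset.sum_le_sum fun z _ => hF _).trans (le_of_eq ?_))
      simp [mul_comm]
    have hjk : ((j.val + 1 : ℕ) : ℝ) + 1 ≤ k + 1 := by
      have := j.2
      gcongr
      omega
    have e4 : |(collisionMean (size m) m (j.val + 1 + 1) (t j) - lam j) *
        ∑ z ∈ D, F (collisions t z)| ≤ ((k : ℝ) + 1) ^ 2 * ((T * ρ) / ε) * (2 * D.card) := by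
      rw [abs_mul]
      refine mul_le_mul (e2.trans ?_) e3 (abs_nonneg _) (by positivity)
      gcongr
    set S1 := ∑ z ∈ D, (collisions t z j * F (collisions t z - Pi.single j 1) : ℝ)
    set S2 := ∑ z ∈ D, F (collisions t z)
    set μ := collisionMean (size m) m (j.val + 1 + 1) (t j)
    have e5 : S1 - lam j * S2 = (S1 - μ * S2) + (μ - lam j) * S2 := by ring
    rw [e5]
    refine (abs_add_le _ _).trans ((add_le_add e1 e4).trans ?_)
    have hτ0 : 0 ≤ T * ρ := by positivity
    have h6 : 0 ≤ D.card * (4 * (((k : ℝ) + 1) * (k + 1) + 1 + k)) * (T * ρ) := by positivity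
    have h7 : 0 ≤ D.card * (2 * (((k : ℝ) + 1) ^ 2 / ε)) * Λ * (T * ρ) := by positivity
    have h8 : D.card * (K * (1 + Λ) * (T * ρ)) =
        (D.card * (4 * (((k : ℝ) + 1) * (k + 1) + 1 + k) * Λ * (T * ρ)) +
          ((k : ℝ) + 1) ^ 2 * ((T * ρ) / ε) * (2 * D.card)) +
        (D.card * (4 * (((k : ℝ) + 1) * (k + 1) + 1 + k)) * (T * ρ) +
          D.card * (2 * (((k : ℝ) + 1) ^ 2 / ε)) * Λ * (T * ρ)) := by
      rw [hK]; ring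
    rw [h8]
    linarith
  have key := abs_sum_sub_integral_pi_poisson_le D (collisions t) (fun j => (lam j).toNNReal)
    (fun j => Real.toNNReal_pos.2 (hpos j)) _ herr (A.indicator 1)
    (fun u => Set.indicator_nonneg (fun _ _ => zero_le_one) u)
    (fun u => Set.indicator_le_self' (fun _ _ => zero_le_one) u)
  rw [integral_indicator_one MeasurableSet.of_discrete] at key
  rw [shuffled_real_preimage, ← hD]
  refine le_of_mul_le_mul_left ?_ hDpos
  nth_rw 1 [← abs_of_pos hDpos]
  rw [← abs_mul, mul_sub, mul_div_cancel₀ _ hDpos.ne']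
  refine key.trans (le_of_eq ?_)
  rw [Finset.sum_const, Finset.card_univ, Fintype.card_fin, nsmul_eq_mul, hτeq]
  ring

/-- The scale `T / n` is controlled by the largest Poisson mean. -/
lemma mul_div_le_rpow (hn : 0 < n) {k : ℕ} {c : ℝ} (hc0 : 0 ≤ c) (hc1 : c ≤ 1)
    (hβ : c ≤ beta m (k + 1)) {T : ℕ} {Λ : ℝ} (hΛ : poissonMean m k T ≤ Λ) :
    c * ((T : ℝ) / n) ≤ (Λ / n) ^ (1 / ((k : ℝ) + 1)) := by
  have hn' : (0 : ℝ) < n := by exact_mod_cast hn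
  have h1 : (c * ((T : ℝ) / n)) ^ (k + 1) ≤ Λ / n := by
    calc (c * ((T : ℝ) / n)) ^ (k + 1) = c ^ (k + 1) * ((T : ℝ) / n) ^ (k + 1) := mul_pow _ _ _
      _ ≤ beta m (k + 1) * ((T : ℝ) / n) ^ (k + 1) := by
        -- Since `c ≤ 1`, `c ^ (k + 1) ≤ c ≤ β_{k+1}`; the root can then be taken with the constant
        -- `c` outside.
        gcongr
        exact (pow_le_of_le_one hc0 hc1 (by omega)).trans hβ
      _ = poissonMean m k T / n := by
        rw [poissonMean, div_pow, pow_succ (n : ℝ)]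
        field_simp
      _ ≤ Λ / n := by gcongr
  have h0 : 0 ≤ c * ((T : ℝ) / n) := by positivity
  calc c * ((T : ℝ) / n) = ((c * ((T : ℝ) / n)) ^ (k + 1)) ^ (((k + 1 : ℕ) : ℝ)⁻¹) :=
        (Real.pow_rpow_inv_natCast h0 (by omega)).symm
    _ ≤ (Λ / n) ^ (((k + 1 : ℕ) : ℝ)⁻¹) := by gcongr
    _ = _ := by push_cast; rw [one_div]

lemma pi_poissonMeasure_real_zero {k : ℕ} {lam : Fin k → ℝ} (hlam : ∀ j, 0 ≤ lam j) :
    (Measure.pi fun j => poissonMeasure (lam j).toNNReal).real {0} = Real.exp (-∑ j, lam j) := by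
  have : ({0} : Set (Fin k → ℕ)) = Set.univ.pi fun _ => {0} := by
    ext u
    simp [funext_iff]
  rw [this, measureReal_def, Measure.pi_pi, ENNReal.toReal_prod, ← Finset.sum_neg_distrib,
    Real.exp_sum]
  refine Finset.prod_congr rfl fun j _ => ?_
  rw [← measureReal_def, poissonMeasure_real_singleton]
  simp [hlam j]

end Laws

end CardDeck

/-! ### Assembly of the theorem. -/

theorem mainTheorem5 (k : ℕ) (hk : 1 ≤ k) (ε : ℝ) (hε : 0 < ε) :
    ∃ C : ℝ, 0 < C ∧
      ∀ (n : ℕ) (m : Fin n → ℕ),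
        k + 1 ≤ CardDeck.maxMult m →
        ε ≤ ((Finset.univ.filter fun i =>
          min (2 * k + 1) (CardDeck.maxMult m) ≤ m i).card : ℝ) / n →
        ε * (CardDeck.maxMult m : ℝ) ≤ CardDeck.avgMult m →
        ∀ t : Fin k → ℕ, Monotone t → (∀ j, 1 ≤ t j ∧ t j ≤ CardDeck.size m) →
        ∀ (lam : Fin k → ℝ) (lamMax : ℝ),
          (∀ j, lam j = CardDeck.poissonMean m (j.val + 1) (t j)) →
          lamMax = ⨆ j, lam j →
          CardDeck.tvDist
              ((CardDeck.shuffled m).map fun z (j : Fin k) => CardDeck.W (j.val + 1) (t j) z)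
              (Measure.pi fun j => poissonMeasure (lam j).toNNReal)
            ≤ C * ((1 + lamMax) * (lamMax / n) ^ (1 / ((k : ℝ) + 1))) ∧
          |(CardDeck.shuffled m).real {z | ∀ j : Fin k, t j ≤ CardDeck.T (j.val + 1) z}
              - Real.exp (-∑ j, lam j)|
            ≤ C * ((1 + lamMax) * (lamMax / n) ^ (1 / ((k : ℝ) + 1))) := by
  open CardDeck in
  have hk' : (0 : ℝ) < k := by exact_mod_cast hk
  set c : ℝ := min 1 (min (ε / (2 * (k : ℝ)) ^ (k + 1))
    (1 / (2 ^ (k + 1) * ((k + 1).factorial : ℝ)))) with hc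
  have hc0 : 0 < c := lt_min one_pos (lt_min (by positivity) (by positivity))
  set K : ℝ := k * (4 * (((k : ℝ) + 1) * (k + 1) + 1 + k) + 2 * (((k : ℝ) + 1) ^ 2 / ε)) with hK
  have hK0 : 0 < K := by positivity
  -- The first summand serves small `T / n`, through the Stein bound. The second makes the right
  -- side at least 1 once `T / n > ε / (4 * k + 5)`.
  refine ⟨K * (2 / ε) / c + (4 * k + 5) / (ε * c), by positivity, ?_⟩
  intro n m hmax hfrac havg t hmono ht lam lamMax hlam hlamMax
  have hn : 0 < n := by
    rcases Nat.eq_zero_or_pos n with rfl | h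
    · simp at hfrac
      linarith
    · exact h
  have hn' : (0 : ℝ) < n := by exact_mod_cast hn
  let last : Fin k := ⟨k - 1, by omega⟩
  set T := t last with hTdef
  have hT : ∀ j, t j ≤ T := fun j => hmono (Fin.le_def.2 (by simp only [last]; omega))
  have hN : 0 < size m := by have := ht last; omega
  have hβ : c ≤ beta m (k + 1) := (min_le_right _ _).trans (le_beta_succ hn hk hN hmax hfrac)
  have hmaxmem : ∃ i, m i = maxMult m := by
    obtain ⟨i, -, hi⟩ := Finset.exists_mem_eq_sup (Finset.univ : Finset (Fin n))
      ⟨⟨0, hn⟩, Finset.mem_univ _⟩ m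
    exact ⟨i, hi.symm⟩
  -- A type of maximal multiplicity has at least `k + 1` cards, so it contributes to every mean.
  have hpos : ∀ j, 0 < lam j := by
    intro j
    obtain ⟨i, hi⟩ := hmaxmem
    have h1 : (0 : ℝ) < ∑ i, ((m i).choose (j.val + 1 + 1) : ℝ) := by
      refine Finset.sum_pos' (fun _ _ => by positivity) ⟨i, Finset.mem_univ _, ?_⟩
      exact_mod_cast Nat.choose_pos (by omega)
    have h2 : (0 : ℝ) < t j := by exact_mod_cast (ht j).1
    rw [hlam, poissonMean_eq hn hN]
    positivity
  have hΛ : ∀ j, lam j ≤ lamMax := fun j => hlamMax ▸ le_ciSup (Set.finite_range _).bddAbove j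
  have hΛ0 : 0 ≤ lamMax := (hpos last).le.trans (hΛ last)
  set X := (lamMax / n) ^ (1 / ((k : ℝ) + 1)) with hX
  have hX0 : 0 ≤ X := by positivity
  have hTX : c * ((T : ℝ) / n) ≤ X := mul_div_le_rpow hn hc0.le (min_le_left _ _) hβ (by
    have := hΛ last
    rwa [hlam, show last.val + 1 = k by simp only [last]; omega] at this)
  have main : ∀ A : Set (Fin k → ℕ), |(shuffled m).real (collisions t ⁻¹' A) -
        (Measure.pi fun j => poissonMeasure (lam j).toNNReal).real A| ≤
      (K * (2 / ε) / c + (4 * k + 5) / (ε * c)) * ((1 + lamMax) * X) := by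
    intro A
    rcases le_or_gt (T : ℝ) (ε / (4 * k + 5) * n) with h | h
    · refine (abs_shuffled_real_sub_le hn hε (by omega) havg t ht hT (ht last).1 (ht last).2 h
        lam hlam hpos hΛ0 hΛ A).trans ?_
      rw [← hK]
      calc K * (1 + lamMax) * (2 / ε * (T / n)) =
            K * (2 / ε) / c * ((1 + lamMax) * (c * ((T : ℝ) / n))) := by field_simp
        _ ≤ K * (2 / ε) / c * ((1 + lamMax) * X) := by gcongr
        _ ≤ _ := by
          gcongr
          exact le_add_of_nonneg_right (by positivity)
    · have h1 : |(shuffled m).real (collisions t ⁻¹' A) -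
          (Measure.pi fun j => poissonMeasure (lam j).toNNReal).real A| ≤ 1 :=
        abs_sub_le_of_nonneg_of_le measureReal_nonneg measureReal_le_one measureReal_nonneg
          measureReal_le_one
      refine h1.trans ?_
      have h2 : ε / (4 * k + 5) ≤ T / n := by
        rw [le_div_iff₀ hn']; exact h.le
      calc (1 : ℝ) = (4 * k + 5) / (ε * c) * (1 * (c * (ε / (4 * k + 5)))) := by field_simp
        _ ≤ (4 * k + 5) / (ε * c) * ((1 + lamMax) * X) := by
          gcongr
          · linarith
          · exact le_trans (by gcongr) hTX
        _ ≤ _ := by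
          gcongr
          exact le_add_of_nonneg_left (by positivity)
  constructor
  · refine Real.iSup_le (fun A => ?_) (by positivity)
    rw [map_measureReal_apply Measurable.of_discrete A.2]
    exact main A.1
  · rw [← pi_poissonMeasure_real_zero fun j => (hpos j).le]
    have hset : {z : Fin (size m) → Fin n | ∀ j : Fin k, t j ≤ CardDeck.T (j.val + 1) z} =
        collisions t ⁻¹' {(0 : Fin k → ℕ)} := by
      ext z
      simp only [Set.mem_preimage, Set.mem_singleton_iff, funext_iff, Pi.zero_apply, collisions]
      exact forall_congr' fun j => le_T_iff (ht j).1 (ht j).2 z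
    rw [hset]
    exact main {0}
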